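/- Definitions. "Preuniform space" means a uniform space that need not be Hausdorff. For a preuniform space $X$, let $U_b(X)$ be the Banach space of bounded uniformly continuous real-valued functions on $X$ with the sup norm, and $U_b(X)^*$ its Banach space dual. A subset of $U_b(X)$ is called ueb if it is uniformly equicontinuous and bounded in the sup norm; the ueb topology on $U_b(X)^*$ is the topology of uniform convergence on ueb sets. The space $\mathsf M(X)$ of uniform measures on $X$ is the closure, in the ueb topology, of the linear span of the point masses $\delta_x\colon f\mapsto f(x)$, $x\in X$, in $U_b(X)^*$; its positive cone $\mathsf M(X)^+$ consists of the $\mu\in\mathsf M(X)$ with $\mu(f)\ge 0$ for all $f\ge 0$ in $U_b(X)$. Both carry the ueb topology. A uniformly continuous map $\varphi\colon X\to Y$ induces the continuous linear map $\mathsf M(\varphi)\colon\mathsf M(X)\to\mathsf M(Y)$, $\mathsf M(\varphi)(\mu)(f)=\mu(f\circ\varphi)$, which maps $\mathsf M(X)^+$ into $\mathsf M(Y)^+$. Let $G$ be a Hausdorff topological group with identity $e$, and let $G_L$, $G_R$ be the set $G$ with its left, respectively right, uniformity (generated by the sets $\{(x,y): x^{-1}y\in U\}$, respectively $\{(x,y):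 yx^{-1}\in U\}$, with $U$ a neighbourhood of $e$). Let $H$ be a closed subgroup of $G$, and let $G/H$ be the set of left cosets $xH$. Let $Q_L=G_L/H$ and $Q_R=G_R/H$ be the set $G/H$ with the finest preuniformity for which the quotient map from $G_L$, respectively $G_R$, is uniformly continuous. Let $Q_\vee=Q_L\vee Q_R$ be $G/H$ with the coarsest preuniformity finer than those of $Q_L$ and $Q_R$, and $Q_\wedge=Q_L\wedge Q_R$ be $G/H$ with the finest preuniformity coarser than those of $Q_L$ and $Q_R$. For $\alpha\beta\in\{\vee L,\vee R,L\wedge,R\wedge,\vee\wedge\}$ let $\iota_{\alpha\beta}\colon Q_\alpha\to Q_\beta$ be the (uniformly continuous) identity map. The subgroup $H$ is called neutral if for every neighbourhood $U$ of $e$ there is a neighbourhood $V$ of $e$ with $HV\subseteq UH$. Theorem (embedding theorem for quotient spaces). (1) Assume that $H$ is neutral. Then for every $\alpha\beta\in\{\vee L,\vee R,L\wedge,R\wedge,\vee\wedge\}$ the map $\mathsf M(\iota_{\alpha\beta})\colon\mathsf M(Q_\alpha)\to\mathsf M(Q_\beta)$ is injective, and its restriction to the positive cone is a topological embedding of $\mathsf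 M(Q_\alpha)^+$ into $\mathsf M(Q_\beta)^+$ with their ueb topologies. Moreover, $$\mathsf M(\iota_{\vee\wedge})(\mathsf M(Q_\vee))=\mathsf M(\iota_{L\wedge})(\mathsf M(Q_L))\cap\mathsf M(\iota_{R\wedge})(\mathsf M(Q_R)).$$ (2) Neutrality is necessary: if the restriction of $\mathsf M(\iota_{\vee L})$ to the positive cone is a topological embedding of $\mathsf M(Q_\vee)^+$ into $\mathsf M(Q_L)^+$ with their ueb topologies, then $H$ is neutral. In particular, if the conclusion of (1) holds then $H$ is neutral. -/

import Mathlib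

open Set Filter Topology
open scoped Uniformity Pointwise BoundedContinuousFunction UniformConvergenceCLM

/-! ### Preuniform spaces, bounded uniformly continuous functions

`UniformSpace` in Mathlib does not include the Hausdorff axiom. -/

/-- The set `S` considered as a space with the (pre)uniform structure `u`. -/
def WithUnif (S : Type*) (_u : UniformSpace S) : Type _ := S

instance WithUnif.instUniformSpace {S : Type*} (u : UniformSpace S) :
    UniformSpace (WithUnif S u) := u

/-- The identity mapping of `S`, seen as a mapping between two (pre)uniform spaces on `S`. -/
def WithUnif.iota {S : Type*} (u v : UniformSpace S) : WithUnif S u → WithUnif S v := fun x => x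

/-- The identity mapping is uniformly continuous from a finer to a coarser structure
(in Mathlib's order, `u ≤ v` means that `u` is finer than `v`). -/
theorem WithUnif.uniformContinuous_iota {S : Type*} {u v : UniformSpace S} (h : u ≤ v) :
    UniformContinuous (WithUnif.iota u v) :=
  tendsto_id'.2 (UniformSpace.le_def.1 h)

/-- The space of bounded uniformly continuous real-valued functions on `X`,
with the sup norm (inherited from `X →ᵇ ℝ`). -/
def Ub (X : Type*) [UniformSpace X] : Submodule ℝ (X →ᵇ ℝ) where
  carrier := {f | UniformContinuous (f : X → ℝ)}
  add_mem' := fun {f _} (hf : UniformContinuous (f : X → ℝ)) hg => hf.add hg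
  zero_mem' := uniformContinuous_const
  smul_mem' := fun c f (hf : UniformContinuous (f : X → ℝ)) => hf.const_smul c

/-- A set of bounded uniformly continuous functions is `ueb` when it is uniformly
equicontinuous and bounded in the sup norm. -/
def IsUeb {X : Type*} [UniformSpace X] (F : Set (Ub X)) : Prop :=
  UniformEquicontinuous (fun f : F => ((f : Ub X) : X → ℝ)) ∧ ∃ C : ℝ, ∀ f ∈ F, ‖f‖ ≤ C

/-- The Banach space dual of `Ub X`, with the `ueb` topology, i.e. the topology of uniform
convergence on the `ueb` sets. -/
abbrev UbDual (X : Type*) [UniformSpace X] : Type _ :=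
  Ub X →Lᵤ[ℝ, {F : Set (Ub X) | IsUeb F}] ℝ

/-- Addition and scalar multiplication are continuous in the `ueb` topology. -/
instance UbDual.instContinuousSMul (X : Type*) [UniformSpace X] :
    ContinuousSMul ℝ (UbDual X) :=
  UniformConvergenceCLM.continuousSMul _ _ _ fun F hF => by
    obtain ⟨C, hC⟩ := hF.2
    exact NormedSpace.isVonNBounded_of_isBounded ℝ (E := Ub X)
      ((isBounded_iff_forall_norm_le (E := Ub X)).2 ⟨C, hC⟩)

/-! ### Uniform measures -/

/-- The point mass at `x`, i.e. the functional `f ↦ f x` on `Ub X`. -/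
noncomputable def pmass {X : Type*} [UniformSpace X] (x : X) : UbDual X :=
  UniformConvergenceCLM.ofFun (RingHom.id ℝ) ℝ _
    ((BoundedContinuousFunction.evalCLM ℝ x).comp (Ub X).subtypeL)

theorem pmass_apply {X : Type*} [UniformSpace X] (x : X) (f : Ub X) :
    pmass x f = (f : X →ᵇ ℝ) x := rfl

/-- The molecular measures: finite linear combinations of point masses. -/
noncomputable def Mol (X : Type*) [UniformSpace X] : Submodule ℝ (UbDual X) :=
  Submodule.span ℝ (Set.range (pmass (X := X)))

/-- The space of uniform measures on `X`: the closure of the space of molecular measures in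
the dual of `Ub X` with the `ueb` topology. It carries the `ueb` topology. -/
noncomputable def UMeas (X : Type*) [UniformSpace X] : Submodule ℝ (UbDual X) :=
  (Mol X).topologicalClosure

/-- The positive cone in the space of uniform measures. -/
def UMeasPos (X : Type*) [UniformSpace X] : Set (UMeas X) :=
  {m | ∀ f : Ub X, (∀ x, 0 ≤ (f : X →ᵇ ℝ) x) → 0 ≤ (m : UbDual X) f}

section Functoriality

variable {X Y : Type*} [UniformSpace X] [UniformSpace Y]

/-- Composition with a uniformly continuous mapping `φ : X → Y`, as an operator
`f ↦ f ∘ φ` from `Ub Y` to `Ub X`. -/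
noncomputable def Ub.compUnif (φ : X → Y) (hφ : UniformContinuous φ) : Ub Y →L[ℝ] Ub X :=
  ((BoundedContinuousFunction.compContinuousCLM (β := ℝ) (𝕜 := ℝ)
    ⟨φ, hφ.continuous⟩).comp (Ub Y).subtypeL).codRestrict (Ub X)
    fun f => (show UniformContinuous ((f : Y →ᵇ ℝ) : Y → ℝ) from f.2).comp hφ

theorem Ub.compUnif_apply (φ : X → Y) (hφ : UniformContinuous φ) (f : Ub Y) (x : X) :
    (Ub.compUnif φ hφ f : X →ᵇ ℝ) x = (f : Y →ᵇ ℝ) (φ x) := rfl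

theorem IsUeb.image_compUnif (φ : X → Y) (hφ : UniformContinuous φ) {F : Set (Ub Y)}
    (hF : IsUeb F) : IsUeb (Ub.compUnif φ hφ '' F) := by
  obtain ⟨hE, C, hC⟩ := hF
  refine ⟨?_, C, ?_⟩
  · intro U hU
    filter_upwards [hφ (hE U hU)] with p hp
    rintro ⟨_, f, hf, rfl⟩
    exact hp ⟨f, hf⟩
  · rintro _ ⟨f, hf, rfl⟩
    exact (BoundedContinuousFunction.norm_compContinuous_le (f : Y →ᵇ ℝ)
      ⟨φ, hφ.continuous⟩).trans (hC f hf)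

/-- The continuous linear mapping `m ↦ (f ↦ m (f ∘ φ))` between the duals with
their `ueb` topologies. -/
noncomputable def UbDual.map (φ : X → Y) (hφ : UniformContinuous φ) : UbDual X →L[ℝ] UbDual Y :=
  ContinuousLinearMap.precompUniformConvergenceCLM ℝ
    {F : Set (Ub Y) | IsUeb F} {F : Set (Ub X) | IsUeb F} (Ub.compUnif φ hφ)
    fun _ hF => IsUeb.image_compUnif φ hφ hF

theorem UbDual.map_apply (φ : X → Y) (hφ : UniformContinuous φ) (m : UbDual X) (f : Ub Y) :
    UbDual.map φ hφ m f = m (Ub.compUnif φ hφ f) := rfl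

theorem UbDual.map_pmass (φ : X → Y) (hφ : UniformContinuous φ) (x : X) :
    UbDual.map φ hφ (pmass x) = pmass (φ x) := rfl

theorem UbDual.map_mem_UMeas (φ : X → Y) (hφ : UniformContinuous φ) {m : UbDual X}
    (hm : m ∈ UMeas X) : UbDual.map φ hφ m ∈ UMeas Y := by
  have h1 : (Mol X).map (UbDual.map φ hφ : UbDual X →ₗ[ℝ] UbDual Y) ≤ Mol Y := by
    rw [Mol, Submodule.map_span_le]
    rintro _ ⟨x, rfl⟩
    exact Submodule.subset_span ⟨φ x, (UbDual.map_pmass φ hφ x).symm⟩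
  exact Submodule.topologicalClosure_mono h1
    (Submodule.topologicalClosure_map (UbDual.map φ hφ) (Mol X) ⟨m, hm, rfl⟩)

/-- The functor on morphisms: the (unique) continuous linear mapping
`UMeas X → UMeas Y` that extends the uniformly continuous mapping `φ : X → Y`
(points being identified with point masses). Explicitly, it sends `m` to `f ↦ m (f ∘ φ)`. -/
noncomputable def UMeas.map (φ : X → Y) (hφ : UniformContinuous φ) : UMeas X →L[ℝ] UMeas Y :=
  ((UbDual.map φ hφ).comp (UMeas X).subtypeL).codRestrict (UMeas Y)
    fun m => UbDual.map_mem_UMeas φ hφ m.2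

theorem UMeas.coe_map (φ : X → Y) (hφ : UniformContinuous φ) (m : UMeas X) :
    (UMeas.map φ hφ m : UbDual Y) = UbDual.map φ hφ m := rfl

theorem UMeas.mapsTo_pos (φ : X → Y) (hφ : UniformContinuous φ) :
    MapsTo (UMeas.map φ hφ) (UMeasPos X) (UMeasPos Y) :=
  fun _ hm f hf => hm (Ub.compUnif φ hφ f) fun x => hf (φ x)

/-- The restriction of `UMeas.map φ` to the positive cones. -/
noncomputable def UMeas.mapPos (φ : X → Y) (hφ : UniformContinuous φ) :
    UMeasPos X → UMeasPos Y :=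
  (UMeas.mapsTo_pos φ hφ).restrict

end Functoriality

/-- The mapping `UMeas.map ι` for the identity mapping `ι` on `S`, from a finer
structure `u` to a coarser structure `v`. -/
noncomputable def extMap {S : Type*} (u v : UniformSpace S) (h : u ≤ v) :
    UMeas (WithUnif S u) →L[ℝ] UMeas (WithUnif S v) :=
  UMeas.map (WithUnif.iota u v) (WithUnif.uniformContinuous_iota h)

/-- The restriction of `extMap` to the positive cones. -/
noncomputable def extMapPos {S : Type*} (u v : UniformSpace S) (h : u ≤ v) :
    UMeasPos (WithUnif S u) → UMeasPos (WithUnif S v) :=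
  UMeas.mapPos (WithUnif.iota u v) (WithUnif.uniformContinuous_iota h)

/-! ### Quotients of topological groups -/

/-- The subgroup `H` is neutral: for every neighbourhood `U` of the identity there is a
neighbourhood `V` of the identity with `HV ⊆ UH`. -/
def IsNeutralSubgroup {G : Type*} [Group G] [TopologicalSpace G] (H : Subgroup G) : Prop :=
  ∀ U ∈ 𝓝 (1 : G), ∃ V ∈ 𝓝 (1 : G), (H : Set G) * V ⊆ U * (H : Set G)

/-- The final structure: the finest (pre)uniform structure on `T` for which `q` is uniformly
continuous from `S` with `u` (the infimum in Mathlib's order is the coarsest structure finer than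
all those listed, and it belongs to the set). -/
@[reducible]
def finalUnif {S T : Type*} (u : UniformSpace S) (q : S → T) : UniformSpace T :=
  sInf {v : UniformSpace T | @UniformContinuous S T u v q}

theorem isLeast_finalUnif {S T : Type*} (u : UniformSpace S) (q : S → T) :
    IsLeast {v : UniformSpace T | @UniformContinuous S T u v q} (finalUnif u q) :=
  ⟨uniformContinuous_sInf_rng.2 fun _ hv => hv, fun _ hv => sInf_le hv⟩

section Quotients

variable {G : Type*} [Group G] [TopologicalSpace G] [IsTopologicalGroup G] (H : Subgroup G)

/-- The structure of `Q_L = G_L / H` on the set `G ⧸ H` of left cosets `xH`. -/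
@[reducible]
def unifL : UniformSpace (G ⧸ H) :=
  finalUnif (IsTopologicalGroup.leftUniformSpace G) (QuotientGroup.mk : G → G ⧸ H)

/-- The structure of `Q_R = G_R / H` on the set `G ⧸ H` of left cosets `xH`. -/
@[reducible]
def unifR : UniformSpace (G ⧸ H) :=
  finalUnif (IsTopologicalGroup.rightUniformSpace G) (QuotientGroup.mk : G → G ⧸ H)

/-- The structure of `Q_∨`: the coarsest structure finer than `Q_L` and `Q_R`
(an infimum in Mathlib's reversed order). -/
@[reducible]
def unifVee : UniformSpace (G ⧸ H) := unifL H ⊓ unifR H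

/-- The structure of `Q_∧`: the finest structure coarser than `Q_L` and `Q_R`
(a supremum in Mathlib's reversed order). -/
@[reducible]
def unifWedge : UniformSpace (G ⧸ H) := unifL H ⊔ unifR H

theorem unifVee_le_L : unifVee H ≤ unifL H := inf_le_left
theorem unifVee_le_R : unifVee H ≤ unifR H := inf_le_right
theorem unifL_le_Wedge : unifL H ≤ unifWedge H := le_sup_left
theorem unifR_le_Wedge : unifR H ≤ unifWedge H := le_sup_right
theorem unifVee_le_Wedge : unifVee H ≤ unifWedge H := (unifVee_le_L H).trans (unifL_le_Wedge H)

end Quotients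

/-!
The proof has an abstract part, on preuniform spaces, and a part on groups.

*Abstract part.* Let `φ : X → Y` be uniformly continuous. On a `ueb` set a uniform measure is
continuous for pointwise convergence, because molecular measures are (`UMeas.exists_finset`).
Suppose there are functions `g` on `Y` with values in `[0, 1]` such that the functions `g ∘ φ` are
uniformly equicontinuous on `X`, equal `1` on arbitrary finite sets, and are supported where some
entourage of `Y`, depending on `g`, is finer than a prescribed entourage of `X`; then `φ` is called
localizing (`IsLocalizing`). For `f` in a `ueb` set on `X` and fixed `g`, the product `f * (g ∘ φ)`
is approximated by inf-convolution by functions coming from a `ueb` set on `Y`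
(`exists_ueb_approx`). Since `m (f * (g ∘ φ))` is close to `m f` for suitable `g`, the measure `m`
is determined by its image in `Y` (`IsLocalizing.injective_map`). If `m` is positive,
`|m f - m (f * (g ∘ φ))|` is controlled by `m (1 - g ∘ φ)`, which stays small for all positive
measures whose images are near that of `m`; this makes the map inducing on positive cones
(`IsLocalizing.isInducing_mapPos`).

For the intersection formula, let `X` carry the join of the structures of `Z₁` and `Z₂`, and let
`n` be a common image in `Y` of uniform measures on `Z₁` and `Z₂`. A norm-preserving Hahn–Banach
extension `m` of `n` to `Ub X` is nearly carried by some of the functions `g` that localize `Z₁`,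
and also by some that localize `Z₂`: multiplying a norming function for `n` by `g` hardly changes
its value, which leaves little total variation for `1 - g` (`UbDual.abs_sub_mul_le`). As these
functions `g` are finite sums of functions with small supports, `m` is approximated by
molecular measures (`exists_UMeas_of_map_eq`).

*Groups.* A gauge `N` (a continuous seminorm on the group) is uniformly continuous for both
the left and the right uniformity, and so are its translates `x ↦ N (a * x * b)`. Left translates
are uniformly equicontinuous for the left uniformity, and right translates for the right one.
Neutrality of `H` carries this over to infima over cosets, and it also provides an explicit base of
`Q_∧`. On the set where `x = α u` with `u` small, a translation `x ↦ v x` is a right translation by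
`u⁻¹ (α⁻¹ v α) u`, which is small when `v` is small enough depending on `α`; so the bumps at the
points of `Q_L` show that `Q_L → Q_∧` is localizing, and similarly for `Q_R`
(`hasLocalBumps_unifL`, `hasLocalBumps_unifR`). Products of the two kinds of functions localize
`Q_∨ → Q_∧`, and the statements on `Q_∨ → Q_L` and `Q_∨ → Q_R` follow by factoring.

Conversely, point masses embed `Q_∨` and `Q_L` topologically in the positive cones, so an embedding
of the cones forces `UH` to be a neighbourhood of the coset `H` in `Q_L`, which is neutrality
(`isNeutralSubgroup_of_isEmbedding`).
-/

/-! ### Uniformly continuous pseudometrics -/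

/-- Every entourage contains the open unit ball of a uniformly continuous pseudometric bounded
by `1`. -/
theorem exists_pseudometric_of_mem_uniformity {X : Type*} [uX : UniformSpace X] {V : Set (X × X)}
    (hV : V ∈ 𝓤 X) :
    ∃ d : X → X → ℝ, (∀ x, d x x = 0) ∧ (∀ x y, d x y = d y x) ∧
      (∀ x y z, d x z ≤ d x y + d y z) ∧ (∀ x y, 0 ≤ d x y) ∧ (∀ x y, d x y ≤ 1) ∧
      (∀ ε > 0, ∀ᶠ p in 𝓤 X, d p.1 p.2 < ε) ∧ ∀ x y, d x y < 1 → (x, y) ∈ V := by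
  have step : ∀ W : {W : Set (X × X) // W ∈ 𝓤 X}, ∃ W' : {W : Set (X × X) // W ∈ 𝓤 X},
      (∀ x y, (x, y) ∈ W'.1 → (y, x) ∈ W.1) ∧
        ∀ x y z, (x, y) ∈ W'.1 → (y, z) ∈ W'.1 → (x, z) ∈ W.1 := by
    rintro ⟨W, hW⟩
    obtain ⟨t, ht, hsymm, hcomp⟩ := comp_symm_mem_uniformity_sets hW
    refine ⟨⟨t, ht⟩, fun x y h => ?_, fun x y z h h' => hcomp ⟨y, h, h'⟩⟩
    exact hcomp ⟨y, refl_mem_uniformity ht, hsymm.symm _ _ h⟩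
  choose next hsymm hcomp using step
  let W : ℕ → {W : Set (X × X) // W ∈ 𝓤 X} := fun n => next^[n] ⟨V, hV⟩
  have hW : ∀ n, W (n + 1) = next (W n) := fun n => Function.iterate_succ_apply' _ _ _
  have hmono : ∀ n, (W (n + 1)).1 ⊆ (W n).1 := by
    rintro n ⟨x, y⟩ h
    rw [hW] at h
    exact hcomp _ _ _ _ h (refl_mem_uniformity (next (W n)).2)
  have hanti : Antitone fun n => (W n).1 := antitone_nat_of_succ_le hmono
  have hbasis : (⨅ n, 𝓟 (W n).1).HasAntitoneBasis fun n => (W n).1 := .iInf_principal hanti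
  let c : UniformSpace.Core X := UniformSpace.Core.mk' (⨅ n, 𝓟 (W n).1)
    (fun r hr x => by
      obtain ⟨n, hn⟩ := hbasis.mem_iff.1 hr
      exact hn (refl_mem_uniformity (W n).2))
    (fun r hr => by
      obtain ⟨n, hn⟩ := hbasis.mem_iff.1 hr
      refine hbasis.mem_iff.2 ⟨n + 1, ?_⟩
      rintro ⟨x, y⟩ h
      rw [hW] at h
      exact hn (hsymm _ _ _ h))
    (fun r hr => by
      obtain ⟨n, hn⟩ := hbasis.mem_iff.1 hr
      refine ⟨(W (n + 1)).1, hbasis.mem (n + 1), ?_⟩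
      rintro ⟨x, z⟩ ⟨y, h, h'⟩
      rw [hW] at h h'
      exact hn (hcomp _ _ _ _ h h'))
  let u : UniformSpace X := UniformSpace.ofCore c
  have hu : @uniformity X u = ⨅ n, 𝓟 (W n).1 := rfl
  have hle : @uniformity X uX ≤ @uniformity X u := by
    rw [hu]
    exact le_iInf fun n => le_principal_iff.2 (W n).2
  have hcount : IsCountablyGenerated (@uniformity X u) := by
    rw [hu]
    exact hbasis.isCountablyGenerated
  obtain ⟨I, hI⟩ := @UniformSpace.metrizable_uniformity X u hcount
  have hVu : V ∈ @uniformity X I.toUniformSpace := by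
    rw [hI, hu]
    exact hbasis.mem 0
  obtain ⟨ε, hε, hεV⟩ := Metric.mem_uniformity_dist.1 hVu
  have hd : ∀ δ > 0, ∀ᶠ p : X × X in @uniformity X uX, I.dist p.1 p.2 < δ := by
    intro δ hδ
    have h : {p : X × X | I.dist p.1 p.2 < δ} ∈ @uniformity X u := by
      rw [← hI]
      exact Metric.dist_mem_uniformity hδ
    exact hle h
  refine ⟨fun x y => min (I.dist x y / ε) 1, ?_, ?_, ?_, ?_, ?_, ?_, ?_⟩
  · intro x
    simp
  · intro x y
    simp only [dist_comm]
  · intro x y z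
    have h0 : ∀ a b, 0 ≤ I.dist a b / ε := fun a b => div_nonneg dist_nonneg hε.le
    have h1 : I.dist x z / ε ≤ I.dist x y / ε + I.dist y z / ε := by
      rw [← add_div]
      exact div_le_div_of_nonneg_right (I.dist_triangle x y z) hε.le
    have hxy := h0 x y
    have hyz := h0 y z
    rcases min_cases (I.dist x y / ε) 1 with h | h <;>
      rcases min_cases (I.dist y z / ε) 1 with h' | h' <;>
      rcases min_cases (I.dist x z / ε) 1 with h'' | h'' <;> linarith
  · intro x y
    exact le_min (div_nonneg dist_nonneg hε.le) zero_le_one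
  · intro x y
    exact min_le_right _ _
  · intro δ hδ
    filter_upwards [hd (δ * ε) (mul_pos hδ hε)] with p hp
    exact (min_le_left _ _).trans_lt ((div_lt_iff₀ hε).2 hp)
  · intro x y h
    rcases min_lt_iff.1 h with h | h
    · exact hεV ((div_lt_one hε).1 h)
    · exact absurd h (lt_irrefl _)

/-! ### Bounded uniformly continuous functions and `ueb` sets -/

section Basic

variable {X Y : Type*} [UniformSpace X] [UniformSpace Y]

/-- A bounded uniformly continuous function, as an element of `Ub X`. -/
noncomputable def Ub.ofFun (f : X → ℝ) (hf : UniformContinuous f) (C : ℝ)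
    (hC : ∀ x, |f x| ≤ C) : Ub X :=
  ⟨BoundedContinuousFunction.ofNormedAddCommGroup f hf.continuous C hC, hf⟩

@[simp]
theorem Ub.ofFun_apply (f : X → ℝ) (hf : UniformContinuous f) (C : ℝ)
    (hC : ∀ x, |f x| ≤ C) (x : X) : (Ub.ofFun f hf C hC : X →ᵇ ℝ) x = f x := rfl

theorem Ub.abs_apply_le_norm (f : Ub X) (x : X) : |(f : X →ᵇ ℝ) x| ≤ ‖f‖ :=
  (f : X →ᵇ ℝ).norm_coe_le_norm x

theorem Ub.norm_le_of_forall_abs_le {f : Ub X} {C : ℝ} (hC : 0 ≤ C)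
    (h : ∀ x, |(f : X →ᵇ ℝ) x| ≤ C) : ‖f‖ ≤ C :=
  (BoundedContinuousFunction.norm_le (f := (f : X →ᵇ ℝ)) hC).2 h

theorem Ub.ext {f g : Ub X} (h : ∀ x, (f : X →ᵇ ℝ) x = (g : X →ᵇ ℝ) x) : f = g :=
  Subtype.ext (BoundedContinuousFunction.ext h)

theorem abs_mul_sub_mul_le {a a' b b' A B : ℝ} (ha : |a| ≤ A) (hb : |b'| ≤ B) :
    |a * b - a' * b'| ≤ A * |b - b'| + B * |a - a'| := by
  have h : a * b - a' * b' = a * (b - b') + b' * (a - a') := by ring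
  rw [h]
  refine (abs_add_le _ _).trans ?_
  rw [abs_mul, abs_mul]
  gcongr

theorem isUeb_iff {F : Set (Ub X)} :
    IsUeb F ↔ (∀ ε > 0, ∀ᶠ p in 𝓤 X, ∀ f ∈ F, |(f : X →ᵇ ℝ) p.1 - (f : X →ᵇ ℝ) p.2| < ε) ∧
      ∃ C : ℝ, 0 ≤ C ∧ ∀ f ∈ F, ∀ x, |(f : X →ᵇ ℝ) x| ≤ C := by
  constructor
  · rintro ⟨h, C, hC⟩
    refine ⟨fun ε hε => ?_, |C|, abs_nonneg C, fun f hf x =>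
      (Ub.abs_apply_le_norm f x).trans ((hC f hf).trans (le_abs_self C))⟩
    filter_upwards [h _ (Metric.dist_mem_uniformity hε)] with p hp f hf
    exact hp ⟨f, hf⟩
  · rintro ⟨h, C, hC, hb⟩
    refine ⟨fun U hU => ?_, C, fun f hf => Ub.norm_le_of_forall_abs_le hC (hb f hf)⟩
    obtain ⟨ε, hε, hU⟩ := Metric.mem_uniformity_dist.1 hU
    filter_upwards [h ε hε] with p hp f
    exact hU (hp f f.2)

theorem IsUeb.union {F F' : Set (Ub X)} (h : IsUeb F) (h' : IsUeb F') : IsUeb (F ∪ F') := by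
  obtain ⟨h1, C, hC, h2⟩ := isUeb_iff.1 h
  obtain ⟨h1', C', -, h2'⟩ := isUeb_iff.1 h'
  refine isUeb_iff.2 ⟨fun ε hε => ?_, max C C', hC.trans (le_max_left _ _), ?_⟩
  · filter_upwards [h1 ε hε, h1' ε hε] with p hp hp'
    rintro f (hf | hf)
    exacts [hp f hf, hp' f hf]
  · rintro f (hf | hf) x
    exacts [(h2 f hf x).trans (le_max_left _ _), (h2' f hf x).trans (le_max_right _ _)]

theorem IsUeb.mono {F F' : Set (Ub X)} (h : IsUeb F') (hF : F ⊆ F') : IsUeb F := by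
  obtain ⟨h1, C, hC, h2⟩ := isUeb_iff.1 h
  refine isUeb_iff.2 ⟨fun ε hε => ?_, C, hC, fun f hf => h2 f (hF hf)⟩
  filter_upwards [h1 ε hε] with p hp f hf using hp f (hF hf)

theorem uniformContinuous_of_abs_sub_lt {f : X → ℝ}
    (h : ∀ ε > 0, ∀ᶠ p in 𝓤 X, |f p.1 - f p.2| < ε) : UniformContinuous f := by
  intro U hU
  obtain ⟨ε, hε, hU⟩ := Metric.mem_uniformity_dist.1 hU
  have h' : ∀ᶠ p in 𝓤 X, (f p.1, f p.2) ∈ U := (h ε hε).mono fun p hp => hU hp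
  exact h'

theorem Ub.eventually_abs_sub_lt (f : Ub X) {ε : ℝ} (hε : 0 < ε) :
    ∀ᶠ p in 𝓤 X, |(f : X →ᵇ ℝ) p.1 - (f : X →ᵇ ℝ) p.2| < ε :=
  (show UniformContinuous ((f : X →ᵇ ℝ) : X → ℝ) from f.2) (Metric.dist_mem_uniformity hε)

theorem isUeb_singleton (f : Ub X) : IsUeb {f} := by
  refine isUeb_iff.2 ⟨fun ε hε => ?_, ‖f‖, norm_nonneg f, ?_⟩
  · filter_upwards [Ub.eventually_abs_sub_lt f hε] with p hp
    rintro _ rfl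
    exact hp
  · rintro _ rfl x
    exact Ub.abs_apply_le_norm _ x

/-- Products from two uniformly equicontinuous bounded families vary uniformly little. -/
theorem eventually_abs_mul_sub_mul_lt {F F' : Set (Ub X)} (h : IsUeb F) (h' : IsUeb F')
    {ε : ℝ} (hε : 0 < ε) :
    ∀ᶠ p in 𝓤 X, ∀ f ∈ F, ∀ g ∈ F', |(f : X →ᵇ ℝ) p.1 * (g : X →ᵇ ℝ) p.1 -
      (f : X →ᵇ ℝ) p.2 * (g : X →ᵇ ℝ) p.2| < ε := by
  obtain ⟨h1, C, hC, h2⟩ := isUeb_iff.1 h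
  obtain ⟨h1', C', hC', h2'⟩ := isUeb_iff.1 h'
  have hδ : 0 < ε / (C + C' + 1) := by positivity
  filter_upwards [h1 _ hδ, h1' _ hδ] with p hp hp' f hf g hg
  refine (abs_mul_sub_mul_le (h2 f hf _) (h2' g hg _)).trans_lt ?_
  have hε' : (C + C' + 1) * (ε / (C + C' + 1)) = ε := by field_simp
  nlinarith [hp f hf, hp' g hg, mul_le_mul_of_nonneg_left (hp f hf).le hC',
    mul_le_mul_of_nonneg_left (hp' g hg).le hC]

/-- The pointwise product in `Ub X`. -/
noncomputable def Ub.mul (f g : Ub X) : Ub X :=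
  Ub.ofFun (fun x => (f : X →ᵇ ℝ) x * (g : X →ᵇ ℝ) x)
    (uniformContinuous_of_abs_sub_lt fun _ hε =>
      (eventually_abs_mul_sub_mul_lt (isUeb_singleton f) (isUeb_singleton g) hε).mono
        fun _ hp => hp f rfl g rfl)
    (‖f‖ * ‖g‖)
    (fun x => by
      rw [abs_mul]
      exact mul_le_mul (Ub.abs_apply_le_norm f x) (Ub.abs_apply_le_norm g x) (abs_nonneg _)
        ((abs_nonneg _).trans (Ub.abs_apply_le_norm f x)))

@[simp]
theorem Ub.mul_apply (f g : Ub X) (x : X) :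
    (Ub.mul f g : X →ᵇ ℝ) x = (f : X →ᵇ ℝ) x * (g : X →ᵇ ℝ) x := rfl

theorem IsUeb.image2_mul {F F' : Set (Ub X)} (h : IsUeb F) (h' : IsUeb F') :
    IsUeb (image2 Ub.mul F F') := by
  obtain ⟨-, C, hC, h2⟩ := isUeb_iff.1 h
  obtain ⟨-, C', hC', h2'⟩ := isUeb_iff.1 h'
  refine isUeb_iff.2 ⟨fun ε hε => ?_, C * C', mul_nonneg hC hC', ?_⟩
  · filter_upwards [eventually_abs_mul_sub_mul_lt h h' hε] with p hp
    rintro _ ⟨f, hf, g, hg, rfl⟩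
    exact hp f hf g hg
  · rintro _ ⟨f, hf, g, hg, rfl⟩ x
    rw [Ub.mul_apply, abs_mul]
    exact mul_le_mul (h2 f hf x) (h2' g hg x) (abs_nonneg _) hC

/-- The constant function `1`. -/
noncomputable def Ub.one : Ub X :=
  Ub.ofFun (fun _ => 1) uniformContinuous_const 1 (by simp)

@[simp]
theorem Ub.one_apply (x : X) : ((Ub.one : Ub X) : X →ᵇ ℝ) x = 1 := rfl

/-! ### The dual space and uniform measures -/

theorem UbDual.exists_bound (m : UbDual X) :
    ∃ M : ℝ, 0 ≤ M ∧ ∀ (f : Ub X) (c : ℝ), 0 ≤ c → (∀ x, |(f : X →ᵇ ℝ) x| ≤ c) →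
      |m f| ≤ M * c := by
  have h1 : m ⁻¹' Metric.ball 0 1 ∈ 𝓝 (0 : Ub X) :=
    (map_continuous m).continuousAt.preimage_mem_nhds
      (by rw [map_zero]; exact Metric.ball_mem_nhds _ one_pos)
  obtain ⟨δ, hδ, hm⟩ := Metric.mem_nhds_iff.1 h1
  refine ⟨2 / δ, by positivity, fun f c hc hf => ?_⟩
  refine le_of_forall_pos_le_add fun ε hε => ?_
  -- scaling `f` into the ball of radius `δ`, with some room in case `c = 0`
  have hη : 0 < c + ε * δ / 2 := by positivity
  have hmem : (δ / 2 / (c + ε * δ / 2)) • f ∈ Metric.ball (0 : Ub X) δ := by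
    rw [Metric.mem_ball, Subtype.dist_eq]
    refine ((BoundedContinuousFunction.dist_le (half_pos hδ).le).2 fun x => ?_).trans_lt
      (half_lt_self hδ)
    rw [Real.dist_eq]
    change |δ / 2 / (c + ε * δ / 2) * (f : X →ᵇ ℝ) x - 0| ≤ δ / 2
    rw [sub_zero]
    rw [abs_mul, abs_of_pos (by positivity), div_mul_eq_mul_div, div_le_iff₀ hη]
    have := hf x
    gcongr
    nlinarith [mul_pos hε hδ]
  have h2 : |m ((δ / 2 / (c + ε * δ / 2)) • f)| < 1 := by
    have := hm hmem
    rwa [mem_preimage, Metric.mem_ball, Real.dist_eq, sub_zero] at this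
  rw [map_smul, smul_eq_mul, abs_mul, abs_of_pos (by positivity), div_mul_eq_mul_div,
    div_lt_iff₀ hη] at h2
  have h3 : 2 / δ * c + ε = (2 / δ) * (c + ε * δ / 2) := by field_simp
  rw [h3, div_mul_eq_mul_div, le_div_iff₀ hδ]
  linarith

theorem UbDual.apply_add (m : UbDual X) (f g : Ub X) : m (f + g) = m f + m g := map_add m f g

theorem UbDual.apply_sub (m : UbDual X) (f g : Ub X) : m (f - g) = m f - m g := map_sub m f g

theorem UbDual.apply_smul (m : UbDual X) (c : ℝ) (f : Ub X) : m (c • f) = c * m f :=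
  map_smul m c f

theorem UbDual.tendsto_nhds_iff {ι : Type*} {l : Filter ι} {a : ι → UbDual X} {m : UbDual X} :
    Tendsto a l (𝓝 m) ↔
      ∀ F : Set (Ub X), IsUeb F → ∀ ε > 0, ∀ᶠ i in l, ∀ f ∈ F, |m f - a i f| < ε := by
  rw [UniformConvergenceCLM.tendsto_iff_tendstoUniformlyOn]
  simp only [Metric.tendstoUniformlyOn_iff, Real.dist_eq]
  rfl

/-- Molecular measures only depend on finitely many values of a function. -/
theorem exists_finset_of_mem_Mol {m : UbDual X} (hm : m ∈ Mol X) :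
    ∃ A : Finset X, ∀ f g : Ub X, (∀ x ∈ A, (f : X →ᵇ ℝ) x = (g : X →ᵇ ℝ) x) → m f = m g := by
  classical
  induction hm using Submodule.span_induction with
  | mem m hm =>
    obtain ⟨x, rfl⟩ := hm
    exact ⟨{x}, fun f g h => h x (Finset.mem_singleton_self x)⟩
  | zero => exact ⟨∅, fun _ _ _ => rfl⟩
  | add m n _ _ hm hn =>
    obtain ⟨A, hA⟩ := hm
    obtain ⟨B, hB⟩ := hn
    refine ⟨A ∪ B, fun f g h => ?_⟩
    change m f + n f = m g + n g
    rw [hA f g fun x hx => h x (Finset.mem_union_left _ hx),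
      hB f g fun x hx => h x (Finset.mem_union_right _ hx)]
  | smul c m _ hm =>
    obtain ⟨A, hA⟩ := hm
    refine ⟨A, fun f g h => ?_⟩
    change c • m f = c • m g
    rw [hA f g h]

theorem mem_UMeas_iff {m : UbDual X} :
    m ∈ UMeas X ↔ ∀ F : Set (Ub X), IsUeb F → ∀ ε > 0, ∃ n ∈ Mol X, ∀ f ∈ F, |m f - n f| < ε := by
  constructor
  · intro hm F hF ε hε
    have h := UbDual.tendsto_nhds_iff.1 (tendsto_id (x := 𝓝 m)) F hF ε hε
    obtain ⟨n, hn, hn'⟩ := mem_closure_iff_nhds.1 hm _ h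
    exact ⟨n, hn', hn⟩
  · intro h
    refine mem_closure_iff_nhds.2 fun t ht => ?_
    have h0 : (fun z => m + z) ⁻¹' t ∈ 𝓝 (0 : UbDual X) :=
      (continuous_const.add continuous_id).continuousAt.preimage_mem_nhds (by simpa using ht)
    obtain ⟨⟨F, ε⟩, ⟨hF, hε⟩, hsub⟩ :=
      (UniformConvergenceCLM.hasBasis_nhds_zero_of_basis (RingHom.id ℝ) ℝ
        {F : Set (Ub X) | IsUeb F} ⟨{0}, isUeb_singleton 0⟩
        (fun F hF F' hF' => ⟨F ∪ F', IsUeb.union hF hF', subset_union_left, subset_union_right⟩)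
        Metric.nhds_basis_ball).mem_iff.1 h0
    obtain ⟨n, hn, hmn⟩ := h F hF ε hε
    refine ⟨n, ?_, hn⟩
    have : n - m ∈ (fun z => m + z) ⁻¹' t := hsub fun f hf => by
      rw [Metric.mem_ball, Real.dist_eq]
      have := hmn f hf
      rw [abs_sub_comm] at this
      change |n f - m f - 0| < ε
      rwa [sub_zero]
    simpa using this

/-- On a `ueb` set, a uniform measure is continuous for pointwise convergence. -/
theorem UMeas.exists_finset {m : UbDual X} (hm : m ∈ UMeas X) {F : Set (Ub X)} (hF : IsUeb F)
    {ε : ℝ} (hε : 0 < ε) :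
    ∃ A : Finset X, ∀ f ∈ F, ∀ g ∈ F, (∀ x ∈ A, (f : X →ᵇ ℝ) x = (g : X →ᵇ ℝ) x) →
      |m f - m g| < ε := by
  obtain ⟨n, hn, hmn⟩ := mem_UMeas_iff.1 hm F hF (ε / 2) (half_pos hε)
  obtain ⟨A, hA⟩ := exists_finset_of_mem_Mol hn
  refine ⟨A, fun f hf g hg h => ?_⟩
  have h1 := abs_lt.1 (hmn f hf)
  have h2 := abs_lt.1 (hmn g hg)
  rw [hA f g h] at h1
  exact abs_lt.2 ⟨by linarith [h1.1, h2.2], by linarith [h1.2, h2.1]⟩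

end Basic

/-! ### Localizing mappings -/

/-- A function `k` on `X` that varies by at most `ε` between points that are close in `Y` is
uniformly within `ε` of a function on `Y` whose modulus of continuity depends only on a
pseudometric on `Y` and on the bound for `k`. The function is the inf-convolution of `k` with a
multiple of the pseudometric. -/
theorem exists_lipschitz_approx {X Y : Type*} [Nonempty X] (φ : X → Y) (k : X → ℝ) {C ε : ℝ} (hC : 0 ≤ C)
    (hk : ∀ x, |k x| ≤ C) {d : Y → Y → ℝ} (d_self : ∀ y, d y y = 0)
    (d_comm : ∀ y z, d y z = d z y) (d_tri : ∀ y z w, d y w ≤ d y z + d z w)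
    (d_nonneg : ∀ y z, 0 ≤ d y z) (d_le : ∀ y z, d y z ≤ 1) (hε : 0 ≤ ε)
    (h : ∀ x x', d (φ x) (φ x') < 1 → k x ≤ k x' + ε) :
    ∃ t : Y → ℝ, (∀ y z, |t y - t z| ≤ 2 * C * d y z) ∧ (∀ y, |t y| ≤ 3 * C) ∧
      ∀ x, |t (φ x) - k x| ≤ ε := by
  have hbdd : ∀ y, BddBelow (range fun x => k x + 2 * C * d (φ x) y) := by
    refine fun y => ⟨-C, ?_⟩
    rintro _ ⟨x, rfl⟩
    have := (abs_le.1 (hk x)).1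
    have := mul_nonneg (mul_nonneg zero_le_two hC) (d_nonneg (φ x) y)
    dsimp only
    linarith
  have hlip : ∀ y z, (⨅ x, k x + 2 * C * d (φ x) y) ≤
      (⨅ x, k x + 2 * C * d (φ x) z) + 2 * C * d y z := by
    intro y z
    rw [← sub_le_iff_le_add]
    refine le_ciInf fun x => ?_
    rw [sub_le_iff_le_add]
    refine (ciInf_le (hbdd y) x).trans ?_
    have := mul_le_mul_of_nonneg_left (d_tri (φ x) z y) (mul_nonneg zero_le_two hC)
    rw [d_comm z y] at this
    linarith
  refine ⟨fun y => ⨅ x, k x + 2 * C * d (φ x) y, fun y z => ?_, fun y => ?_, fun x => ?_⟩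
  · refine abs_le.2 ⟨?_, ?_⟩
    · have := hlip z y
      rw [d_comm] at this
      linarith
    · have := hlip y z
      linarith
  · refine abs_le.2 ⟨le_ciInf fun x => ?_, ?_⟩
    · have := (abs_le.1 (hk x)).1
      have := mul_nonneg (mul_nonneg zero_le_two hC) (d_nonneg (φ x) y)
      linarith
    · obtain ⟨x⟩ := ‹Nonempty X›
      refine (ciInf_le (hbdd y) x).trans ?_
      have := (abs_le.1 (hk x)).2
      have := mul_le_mul_of_nonneg_left (d_le (φ x) y) (mul_nonneg zero_le_two hC)
      linarith
  · refine abs_le.2 ⟨?_, ?_⟩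
    · rw [le_sub_iff_add_le]
      refine le_ciInf fun x' => ?_
      rcases lt_or_ge (d (φ x') (φ x)) 1 with hd | hd
      · have := h x x' (by rwa [d_comm])
        have := mul_nonneg (mul_nonneg zero_le_two hC) (d_nonneg (φ x') (φ x))
        linarith
      · have := (abs_le.1 (hk x')).1
        have := (abs_le.1 (hk x)).2
        have := mul_le_mul_of_nonneg_left hd (mul_nonneg zero_le_two hC)
        linarith
    · have := ciInf_le (hbdd (φ x)) x
      simp only [d_self, mul_zero, add_zero] at this
      linarith

section Localizing

variable {X Y : Type*} [UniformSpace X] [UniformSpace Y]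

/-- A uniformly continuous mapping `φ : X → Y` is localizing when, for every entourage `W` of `X`,
there are enough functions `g` on `Y` such that on the support of `g ∘ φ` some entourage of `Y`
(depending on `g`) is finer than `W`. Enough means that, although the functions `g` need not be
uniformly equicontinuous on `Y`, the functions `g ∘ φ` are uniformly equicontinuous on `X`, and
every finite subset of `X` is contained in some set where `g ∘ φ = 1`. -/
def IsLocalizing (φ : X → Y) (hφ : UniformContinuous φ) : Prop :=
  ∀ W ∈ 𝓤 X, ∃ 𝒢 : Set (Ub Y), IsUeb (Ub.compUnif φ hφ '' 𝒢) ∧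
    (∀ g ∈ 𝒢, ∀ y, 0 ≤ (g : Y →ᵇ ℝ) y ∧ (g : Y →ᵇ ℝ) y ≤ 1) ∧
    (∀ A : Finset X, ∃ g ∈ 𝒢, ∀ x ∈ A, (g : Y →ᵇ ℝ) (φ x) = 1) ∧
    ∀ g ∈ 𝒢, ∃ V ∈ 𝓤 Y, ∀ x x', (g : Y →ᵇ ℝ) (φ x) ≠ 0 → (φ x, φ x') ∈ V → (x, x') ∈ W

/-- If an entourage of `Y` is finer, on the support of `g ∘ φ`, than an entourage of `X` for which
the functions in `F` vary by at most `ε`, then the products `f * (g ∘ φ)` with `f ∈ F` are uniformly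
approximated by the functions `t ∘ φ` with `t` in a `ueb` set on `Y`. -/
theorem exists_ueb_approx {φ : X → Y} {F : Set (Ub X)} {ε C : ℝ} (hε : 0 < ε) (hC : 0 ≤ C)
    (hFC : ∀ f ∈ F, ∀ x, |(f : X →ᵇ ℝ) x| ≤ C) {W : Set (X × X)}
    (hW : ∀ p ∈ W, ∀ f ∈ F, |(f : X →ᵇ ℝ) p.1 - (f : X →ᵇ ℝ) p.2| < ε) {g : Ub Y}
    (hg : ∀ y, 0 ≤ (g : Y →ᵇ ℝ) y ∧ (g : Y →ᵇ ℝ) y ≤ 1) {V : Set (Y × Y)} (hV : V ∈ 𝓤 Y)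
    (hVW : ∀ x x', (g : Y →ᵇ ℝ) (φ x) ≠ 0 → (φ x, φ x') ∈ V → (x, x') ∈ W) :
    ∃ T : Ub X → Ub Y, IsUeb (T '' F) ∧
      ∀ f ∈ F, ∀ x, |(T f : Y →ᵇ ℝ) (φ x) - (f : X →ᵇ ℝ) x * (g : Y →ᵇ ℝ) (φ x)| ≤ 2 * ε := by
  rcases isEmpty_or_nonempty X with hX | hX
  · refine ⟨fun _ => 0, (isUeb_singleton 0).mono ?_, fun f _ x => (hX.false x).elim⟩
    rintro _ ⟨f, -, rfl⟩
    rfl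
  have hδ : 0 < ε / (C + 1) := by positivity
  have hV' : V ∩ Prod.swap ⁻¹' V ∩
      {p | |(g : Y →ᵇ ℝ) p.1 - (g : Y →ᵇ ℝ) p.2| < ε / (C + 1)} ∈ 𝓤 Y :=
    inter_mem (inter_mem hV (symm_le_uniformity hV)) (Ub.eventually_abs_sub_lt g hδ)
  obtain ⟨d, d_self, d_comm, d_tri, d_nonneg, d_le, d_unif, hd⟩ :=
    exists_pseudometric_of_mem_uniformity hV'
  have key : ∀ f ∈ F, ∀ x x', d (φ x) (φ x') < 1 →
      (f : X →ᵇ ℝ) x * (g : Y →ᵇ ℝ) (φ x) ≤ (f : X →ᵇ ℝ) x' * (g : Y →ᵇ ℝ) (φ x') + 2 * ε := by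
    intro f hf x x' hxx'
    obtain ⟨⟨h1, h2⟩, h3⟩ := hd _ _ hxx'
    by_cases hzero : (g : Y →ᵇ ℝ) (φ x) = 0 ∧ (g : Y →ᵇ ℝ) (φ x') = 0
    · rw [hzero.1, hzero.2]
      linarith
    have hff : |(f : X →ᵇ ℝ) x - (f : X →ᵇ ℝ) x'| < ε := by
      by_cases h0 : (g : Y →ᵇ ℝ) (φ x) = 0
      · rw [abs_sub_comm]
        exact hW _ (hVW x' x (fun h => hzero ⟨h0, h⟩) h2) f hf
      · exact hW _ (hVW x x' h0 h1) f hf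
    have hgb : |(g : Y →ᵇ ℝ) (φ x')| ≤ 1 := abs_le.2 ⟨by linarith [(hg (φ x')).1], (hg _).2⟩
    have h4 := (le_abs_self _).trans (abs_mul_sub_mul_le (a' := (f : X →ᵇ ℝ) x')
      (b := (g : Y →ᵇ ℝ) (φ x)) (hFC f hf x) hgb)
    have h5 : C * |(g : Y →ᵇ ℝ) (φ x) - (g : Y →ᵇ ℝ) (φ x')| ≤ ε := by
      refine (mul_le_mul_of_nonneg_left (le_of_lt h3) hC).trans ?_
      rw [mul_div_assoc', div_le_iff₀ (by positivity)]
      nlinarith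
    linarith
  have hkC : ∀ f ∈ F, ∀ x, |(f : X →ᵇ ℝ) x * (g : Y →ᵇ ℝ) (φ x)| ≤ C := by
    intro f hf x
    rw [abs_mul, abs_of_nonneg (hg _).1]
    exact (mul_le_of_le_one_right (abs_nonneg _) (hg _).2).trans (hFC f hf x)
  have hex : ∀ f ∈ F, ∃ t : Ub Y, (∀ y z, |(t : Y →ᵇ ℝ) y - (t : Y →ᵇ ℝ) z| ≤ 2 * C * d y z) ∧
      (∀ y, |(t : Y →ᵇ ℝ) y| ≤ 3 * C) ∧
      ∀ x, |(t : Y →ᵇ ℝ) (φ x) - (f : X →ᵇ ℝ) x * (g : Y →ᵇ ℝ) (φ x)| ≤ 2 * ε := by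
    intro f hf
    obtain ⟨t, ht, htC, happ⟩ := exists_lipschitz_approx φ
      (fun x => (f : X →ᵇ ℝ) x * (g : Y →ᵇ ℝ) (φ x)) hC (hkC f hf) d_self d_comm d_tri
      d_nonneg d_le (mul_pos two_pos hε).le (key f hf)
    refine ⟨Ub.ofFun t (uniformContinuous_of_abs_sub_lt fun η hη => ?_) _ htC, ht, htC, happ⟩
    filter_upwards [d_unif (η / (2 * C + 1)) (by positivity)] with p hp
    refine (ht _ _).trans_lt ?_
    have h1 := (lt_div_iff₀ (by positivity)).1 hp
    nlinarith [d_nonneg p.1 p.2]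
  choose! T hT hTC happ using hex
  refine ⟨T, isUeb_iff.2 ⟨fun η hη => ?_, 3 * C, by positivity, ?_⟩, happ⟩
  · filter_upwards [d_unif (η / (2 * C + 1)) (by positivity)] with p hp
    rintro _ ⟨f, hf, rfl⟩
    refine (hT f hf _ _).trans_lt ?_
    have h1 := (lt_div_iff₀ (by positivity)).1 hp
    nlinarith [d_nonneg p.1 p.2]
  · rintro _ ⟨f, hf, rfl⟩
    exact hTC f hf

theorem UMeas.map_apply {φ : X → Y} (hφ : UniformContinuous φ) (m : UMeas X) (f : Ub Y) :
    (UMeas.map φ hφ m : UbDual Y) f = (m : UbDual X) (Ub.compUnif φ hφ f) := rfl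

/-- Along a localizing mapping, a uniform measure `m` is determined by its image: `m f` is the
limit of the values at the products `f * (g ∘ φ)`, which are approximated by functions on `Y`. -/
theorem IsLocalizing.injective_map {φ : X → Y} {hφ : UniformContinuous φ}
    (h : IsLocalizing φ hφ) : Function.Injective (UMeas.map φ hφ) := by
  refine (injective_iff_map_eq_zero _).2 fun m hm => ?_
  refine Subtype.ext (UniformConvergenceCLM.ext _ _ fun f => ?_)
  change (m : UbDual X) f = 0
  obtain ⟨M, hM, hbound⟩ := UbDual.exists_bound (m : UbDual X)
  refine abs_nonpos_iff.1 (le_of_forall_pos_le_add fun δ hδ => ?_)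
  rw [zero_add]
  set ε : ℝ := δ / (2 * M + 1) with hε_def
  have hε : 0 < ε := by positivity
  obtain ⟨𝒢, hueb, h01, hfin, hloc⟩ := h _ (Ub.eventually_abs_sub_lt f hε)
  obtain ⟨A, hA⟩ := UMeas.exists_finset m.2
    ((isUeb_singleton f).union ((isUeb_singleton f).image2_mul hueb)) hε
  obtain ⟨g, hg, hgA⟩ := hfin A
  obtain ⟨V, hV, hVW⟩ := hloc g hg
  obtain ⟨T, -, hT⟩ := exists_ueb_approx (F := {f}) (φ := φ) hε (norm_nonneg f)
    (by rintro _ rfl; exact Ub.abs_apply_le_norm _) (by rintro p hp _ rfl; exact hp)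
    (h01 g hg) hV hVW
  have h1 := hA f (Or.inl rfl) (Ub.mul f (Ub.compUnif φ hφ g))
    (Or.inr ⟨f, rfl, _, ⟨g, hg, rfl⟩, rfl⟩)
    (fun x hx => by rw [Ub.mul_apply, Ub.compUnif_apply, hgA x hx, mul_one])
  have h2 : (m : UbDual X) (Ub.compUnif φ hφ (T f)) = 0 := by
    rw [← UMeas.map_apply, hm]
    rfl
  have h3 := hbound (Ub.compUnif φ hφ (T f) - Ub.mul f (Ub.compUnif φ hφ g)) (2 * ε)
    (by positivity) (hT f rfl)
  rw [UbDual.apply_sub, h2, zero_sub, abs_neg] at h3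
  have h4 : (2 * M + 1) * ε = δ := by
    rw [hε_def]
    field_simp
  have h5 := abs_sub_abs_le_abs_sub ((m : UbDual X) f)
    ((m : UbDual X) (Ub.mul f (Ub.compUnif φ hφ g)))
  linarith

theorem UMeasPos.abs_apply_le {m : UMeas X} (hm : m ∈ UMeasPos X) {f h : Ub X}
    (hfh : ∀ x, |(f : X →ᵇ ℝ) x| ≤ (h : X →ᵇ ℝ) x) : |(m : UbDual X) f| ≤ (m : UbDual X) h := by
  have h1 := hm (h - f) fun x => sub_nonneg.2 ((le_abs_self _).trans (hfh x))
  have h2 := hm (h + f) fun x => neg_le_iff_add_nonneg.1 ((neg_le_abs _).trans (hfh x))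
  rw [UbDual.apply_sub] at h1
  rw [UbDual.apply_add] at h2
  exact abs_le.2 ⟨by linarith, by linarith⟩

/-- Along a localizing mapping, convergence of positive uniform measures can be checked on the
images: the values at `f * (1 - g ∘ φ)` are small for all measures near a given one, because they
are controlled by the values at `1 - g ∘ φ`. -/
theorem IsLocalizing.isInducing_mapPos {φ : X → Y} {hφ : UniformContinuous φ}
    (h : IsLocalizing φ hφ) : IsInducing (UMeas.mapPos φ hφ) := by
  refine isInducing_iff_nhds.2 fun m₀ => le_antisymm ?_ ?_
  · exact map_le_iff_le_comap.1 (((UMeas.map φ hφ).continuous.restrict _).tendsto m₀)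
  set l := comap (UMeas.mapPos φ hφ) (𝓝 (UMeas.mapPos φ hφ m₀)) with hl
  have hlY : Tendsto (fun m : UMeasPos X => ((UMeas.mapPos φ hφ m : UMeas Y) : UbDual Y)) l
      (𝓝 ((UMeas.mapPos φ hφ m₀ : UMeas Y) : UbDual Y)) :=
    ((continuous_subtype_val.comp continuous_subtype_val).tendsto _).comp tendsto_comap
  suffices hlX : Tendsto (fun m : UMeasPos X => ((m : UMeas X) : UbDual X)) l
      (𝓝 ((m₀ : UMeas X) : UbDual X)) by
    rw [IsInducing.subtypeVal.nhds_eq_comap, IsInducing.subtypeVal.nhds_eq_comap, comap_comap]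
    exact map_le_iff_le_comap.1 hlX
  refine UbDual.tendsto_nhds_iff.2 fun F hF δ hδ => ?_
  obtain ⟨hequi, C, hC, hFC⟩ := isUeb_iff.1 hF
  set M := ((m₀ : UMeas X) : UbDual X) Ub.one with hM_def
  have hM : 0 ≤ M := m₀.2 Ub.one fun _ => zero_le_one
  set ε : ℝ := δ / (3 * C + 4 * M + 4) with hε_def
  have hε : 0 < ε := by positivity
  obtain ⟨𝒢, hueb, h01, hfin, hloc⟩ := h _ (hequi ε hε)
  obtain ⟨A, hA⟩ := UMeas.exists_finset (m₀ : UMeas X).2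
    ((isUeb_singleton Ub.one).union hueb) hε
  obtain ⟨g, hg, hgA⟩ := hfin A
  obtain ⟨V, hV, hVW⟩ := hloc g hg
  obtain ⟨T, hTF, hT⟩ := exists_ueb_approx hε hC hFC (fun p hp => hp) (h01 g hg) hV hVW
  have hg₀ := hA Ub.one (Or.inl rfl) (Ub.compUnif φ hφ g) (Or.inr ⟨g, hg, rfl⟩)
    (fun x hx => by rw [Ub.compUnif_apply, hgA x hx, Ub.one_apply])
  have e1 := UbDual.tendsto_nhds_iff.1 hlY _ hTF ε hε
  have e2 := UbDual.tendsto_nhds_iff.1 hlY _ (isUeb_singleton (Ub.one - g)) ε hε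
  have e3 := UbDual.tendsto_nhds_iff.1 hlY _ (isUeb_singleton Ub.one) 1 one_pos
  filter_upwards [e1, e2, e3] with m h1 h2 h3 f hf
  have h1 : |((m₀ : UMeas X) : UbDual X) (Ub.compUnif φ hφ (T f)) -
    ((m : UMeas X) : UbDual X) (Ub.compUnif φ hφ (T f))| < ε := h1 (T f) ⟨f, hf, rfl⟩
  have h2 : |((m₀ : UMeas X) : UbDual X) (Ub.one - Ub.compUnif φ hφ g) -
    ((m : UMeas X) : UbDual X) (Ub.one - Ub.compUnif φ hφ g)| < ε := h2 _ rfl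
  have h3 : |M - ((m : UMeas X) : UbDual X) Ub.one| < 1 := h3 _ rfl
  -- the two estimates that hold for every positive measure
  have hpos : ∀ n : UMeasPos X,
      |((n : UMeas X) : UbDual X) (f - Ub.mul f (Ub.compUnif φ hφ g))| ≤
        C * ((n : UMeas X) : UbDual X) (Ub.one - Ub.compUnif φ hφ g) ∧
      |((n : UMeas X) : UbDual X) (Ub.compUnif φ hφ (T f) - Ub.mul f (Ub.compUnif φ hφ g))| ≤
        2 * ε * ((n : UMeas X) : UbDual X) Ub.one := by
    intro n
    constructor
    · have := UMeasPos.abs_apply_le n.2 (f := f - Ub.mul f (Ub.compUnif φ hφ g))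
        (h := C • (Ub.one - Ub.compUnif φ hφ g)) (fun x => by
          change |(f : X →ᵇ ℝ) x - (f : X →ᵇ ℝ) x * (g : Y →ᵇ ℝ) (φ x)| ≤
            C * (1 - (g : Y →ᵇ ℝ) (φ x))
          rw [← mul_one_sub, abs_mul, abs_of_nonneg (sub_nonneg.2 (h01 g hg _).2)]
          exact mul_le_mul_of_nonneg_right (hFC f hf x) (sub_nonneg.2 (h01 g hg _).2))
      rwa [UbDual.apply_smul] at this
    · have := UMeasPos.abs_apply_le n.2
        (f := Ub.compUnif φ hφ (T f) - Ub.mul f (Ub.compUnif φ hφ g))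
        (h := (2 * ε) • Ub.one) (fun x => by
          change _ ≤ 2 * ε * 1
          rw [mul_one]
          exact hT f hf x)
      rwa [UbDual.apply_smul] at this
  obtain ⟨p1, p2⟩ := hpos m₀
  obtain ⟨q1, q2⟩ := hpos m
  rw [UbDual.apply_sub, UbDual.apply_sub] at p1 q1 h2
  rw [UbDual.apply_sub] at p2 q2
  have hg₀' := abs_lt.1 hg₀
  have p1' := abs_le.1 p1
  have p2' := abs_le.1 p2
  have q1' := abs_le.1 q1
  have q2' := abs_le.1 q2
  have h1' := abs_lt.1 h1
  have h2' := abs_lt.1 h2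
  have h3' := abs_lt.1 h3
  have b1 : C * (((m₀ : UMeas X) : UbDual X) Ub.one -
      ((m₀ : UMeas X) : UbDual X) (Ub.compUnif φ hφ g)) ≤ C * ε :=
    mul_le_mul_of_nonneg_left hg₀'.2.le hC
  have b2 : C * (((m : UMeas X) : UbDual X) Ub.one -
      ((m : UMeas X) : UbDual X) (Ub.compUnif φ hφ g)) ≤ C * (2 * ε) :=
    mul_le_mul_of_nonneg_left (by linarith) hC
  have b3 : 2 * ε * ((m : UMeas X) : UbDual X) Ub.one ≤ 2 * ε * (M + 1) :=
    mul_le_mul_of_nonneg_left (by linarith) (by positivity)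
  have hδε : (3 * C + 4 * M + 4) * ε = δ := by
    rw [hε_def]
    field_simp
  rw [← hδε]
  refine abs_lt.2 ⟨?_, ?_⟩ <;> linarith

theorem IsLocalizing.isEmbedding_mapPos {φ : X → Y} {hφ : UniformContinuous φ}
    (h : IsLocalizing φ hφ) : IsEmbedding (UMeas.mapPos φ hφ) :=
  ⟨h.isInducing_mapPos, (UMeas.mapsTo_pos φ hφ).restrict_inj.2 h.injective_map.injOn⟩

end Localizing

/-! ### Partitions of unity -/

section Partitions

variable {X Y : Type*} [UniformSpace X] [UniformSpace Y]

@[simp]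
theorem Ub.sum_apply {ι : Type*} (A : Finset ι) (p : ι → Ub X) (x : X) :
    ((∑ a ∈ A, p a : Ub X) : X →ᵇ ℝ) x = ∑ a ∈ A, (p a : X →ᵇ ℝ) x := by
  classical
  induction A using Finset.induction_on with
  | empty => rfl
  | insert a A ha ih =>
    rw [Finset.sum_insert ha, Finset.sum_insert ha, ← ih]
    rfl

/-- Finitely many functions `ψ a` with values in `[0, 1]` have a maximum that is a sum of
non-negative functions `p a`, each vanishing where `ψ a` does. Only the properties of the
maximum used later are listed, the last being that its oscillation is controlled by that of
the functions `ψ a` independently of their number. -/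
theorem exists_partition {ι : Type*} (ψ : ι → Ub Y)
    (h01 : ∀ a y, 0 ≤ (ψ a : Y →ᵇ ℝ) y ∧ (ψ a : Y →ᵇ ℝ) y ≤ 1) (A : Finset ι) :
    ∃ p : ι → Ub Y, (∀ a y, 0 ≤ (p a : Y →ᵇ ℝ) y) ∧
      (∀ a y, (p a : Y →ᵇ ℝ) y ≠ 0 → (ψ a : Y →ᵇ ℝ) y ≠ 0) ∧
      (∀ y, ∑ a ∈ A, (p a : Y →ᵇ ℝ) y ≤ 1) ∧
      (∀ a ∈ A, ∀ y, (ψ a : Y →ᵇ ℝ) y ≤ ∑ b ∈ A, (p b : Y →ᵇ ℝ) y) ∧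
      ∀ y z δ, 0 ≤ δ → (∀ a, |(ψ a : Y →ᵇ ℝ) y - (ψ a : Y →ᵇ ℝ) z| ≤ δ) →
        |∑ a ∈ A, (p a : Y →ᵇ ℝ) y - ∑ a ∈ A, (p a : Y →ᵇ ℝ) z| ≤ δ := by
  classical
  induction A using Finset.induction_on with
  | empty =>
    refine ⟨0, fun _ _ => le_rfl, fun _ _ h => (h rfl).elim, fun y => ?_, ?_, ?_⟩
    · simp
    · simp
    · intro y z δ hδ _
      simpa using hδ
  | insert b A hb ih =>
    obtain ⟨p, h0, hsupp, h1, hle, hosc⟩ := ih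
    have hmax : UniformContinuous fun y =>
        max (∑ a ∈ A, (p a : Y →ᵇ ℝ) y) ((ψ b : Y →ᵇ ℝ) y) - ∑ a ∈ A, (p a : Y →ᵇ ℝ) y := by
      refine uniformContinuous_of_abs_sub_lt fun ε hε => ?_
      filter_upwards [Ub.eventually_abs_sub_lt (∑ a ∈ A, p a) (half_pos hε),
        Ub.eventually_abs_sub_lt (ψ b) (half_pos hε)] with y hy hy'
      rw [Ub.sum_apply, Ub.sum_apply] at hy
      have h := (abs_max_sub_max_le_max (∑ a ∈ A, (p a : Y →ᵇ ℝ) y.1) ((ψ b : Y →ᵇ ℝ) y.1)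
        (∑ a ∈ A, (p a : Y →ᵇ ℝ) y.2) ((ψ b : Y →ᵇ ℝ) y.2)).trans_lt (max_lt hy hy')
      rw [abs_lt] at h hy ⊢
      constructor <;> linarith
    have hS0 : ∀ y, 0 ≤ ∑ a ∈ A, (p a : Y →ᵇ ℝ) y := fun y => Finset.sum_nonneg fun a _ => h0 a y
    -- the new summand is what the maximum gains from `ψ b`; it vanishes where `ψ b` does
    let q : Ub Y := Ub.ofFun _ hmax 1 (fun y => by
      have := max_le (h1 y) (h01 b y).2
      have := le_max_left (∑ a ∈ A, (p a : Y →ᵇ ℝ) y) ((ψ b : Y →ᵇ ℝ) y)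
      rw [abs_le]
      constructor <;> linarith [hS0 y])
    have hsum : ∀ y, ∑ a ∈ insert b A, (Function.update p b q a : Y →ᵇ ℝ) y =
        max (∑ a ∈ A, (p a : Y →ᵇ ℝ) y) ((ψ b : Y →ᵇ ℝ) y) := by
      intro y
      have hA : ∑ a ∈ A, (Function.update p b q a : Y →ᵇ ℝ) y = ∑ a ∈ A, (p a : Y →ᵇ ℝ) y :=
        Finset.sum_congr rfl fun a ha => by
          rw [Function.update_of_ne (ne_of_mem_of_not_mem ha hb)]
      rw [Finset.sum_insert hb, hA, Function.update_self, Ub.ofFun_apply]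
      ring
    refine ⟨Function.update p b q, fun a y => ?_, fun a y h => ?_, fun y => ?_,
      fun a ha y => ?_, fun y z δ hδ h => ?_⟩
    · by_cases hab : a = b
      · subst hab
        rw [Function.update_self]
        exact sub_nonneg.2 (le_max_left _ _)
      · rw [Function.update_of_ne hab]
        exact h0 a y
    · by_cases hab : a = b
      · subst hab
        rw [Function.update_self, Ub.ofFun_apply] at h
        intro h'
        rw [h', max_eq_left (hS0 y), sub_self] at h
        exact h rfl
      · rw [Function.update_of_ne hab] at h
        exact hsupp a y h
    · rw [hsum]
      exact max_le (h1 y) (h01 b y).2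
    · rw [hsum]
      rcases Finset.mem_insert.1 ha with rfl | ha
      · exact le_max_right _ _
      · exact (hle a ha y).trans (le_max_left _ _)
    · rw [hsum, hsum]
      exact (abs_max_sub_max_le_max _ _ _ _).trans (max_le (hosc y z δ hδ h) (h b))

/-- A mapping `φ : X → Y` has local bumps when, for every entourage `W` of `X`, every point of `X`
has a bump function `ψ a` on `Y` such that the functions `ψ a ∘ φ` are uniformly equicontinuous
on `X` and have `W`-small supports, and on the support of each `ψ a ∘ φ` some entourage of `Y`
is finer than `W`. -/
def HasLocalBumps (φ : X → Y) : Prop :=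
  ∀ W ∈ 𝓤 X, ∃ ψ : X → Ub Y, (∀ a y, 0 ≤ (ψ a : Y →ᵇ ℝ) y ∧ (ψ a : Y →ᵇ ℝ) y ≤ 1) ∧
    (∀ ε > 0, ∀ᶠ x in 𝓤 X, ∀ a, |(ψ a : Y →ᵇ ℝ) (φ x.1) - (ψ a : Y →ᵇ ℝ) (φ x.2)| < ε) ∧
    (∀ a, (ψ a : Y →ᵇ ℝ) (φ a) = 1) ∧
    (∀ a x, (ψ a : Y →ᵇ ℝ) (φ x) ≠ 0 → (a, x) ∈ W) ∧
    ∀ a, ∃ V ∈ 𝓤 Y, ∀ x x', (ψ a : Y →ᵇ ℝ) (φ x) ≠ 0 → (φ x, φ x') ∈ V → (x, x') ∈ W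

/-- Local bumps can be assembled into finite partitions of functions `∑ a ∈ A, p A a` that
witness that the mapping is localizing. -/
theorem HasLocalBumps.exists_partitions {φ : X → Y} (hφ : UniformContinuous φ)
    (h : HasLocalBumps φ) {W : Set (X × X)} (hW : W ∈ 𝓤 X) :
    ∃ p : Finset X → X → Ub Y, (∀ A a y, 0 ≤ (p A a : Y →ᵇ ℝ) y) ∧
      (∀ A y, ((∑ a ∈ A, p A a : Ub Y) : Y →ᵇ ℝ) y ≤ 1) ∧
      IsUeb (Ub.compUnif φ hφ '' range fun A => ∑ a ∈ A, p A a) ∧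
      (∀ A, ∀ x ∈ A, ((∑ a ∈ A, p A a : Ub Y) : Y →ᵇ ℝ) (φ x) = 1) ∧
      (∀ A a x, (p A a : Y →ᵇ ℝ) (φ x) ≠ 0 → (a, x) ∈ W) ∧
      ∀ A, ∃ V ∈ 𝓤 Y, ∀ x x', ((∑ a ∈ A, p A a : Ub Y) : Y →ᵇ ℝ) (φ x) ≠ 0 →
        (φ x, φ x') ∈ V → (x, x') ∈ W := by
  obtain ⟨ψ, h01, hequi, hone, hsmall, hV⟩ := h W hW
  choose p p0 psupp p1 ple posc using fun A : Finset X => exists_partition ψ h01 A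
  have hsum0 : ∀ (A : Finset X) (y : Y), 0 ≤ ∑ a ∈ A, (p A a : Y →ᵇ ℝ) y :=
    fun A y => Finset.sum_nonneg fun a _ => p0 A a y
  refine ⟨p, p0, fun A y => by simpa using p1 A y, isUeb_iff.2 ⟨fun ε hε => ?_, 1, zero_le_one, ?_⟩,
    fun A x hx => ?_, fun A a x hx => hsmall a x (psupp A a _ hx), fun A => ?_⟩
  · filter_upwards [hequi (ε / 2) (half_pos hε)] with x hx
    rintro _ ⟨_, ⟨A, rfl⟩, rfl⟩
    simp only [Ub.compUnif_apply, Ub.sum_apply]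
    exact (posc A _ _ _ (half_pos hε).le fun a => (hx a).le).trans_lt (half_lt_self hε)
  · rintro _ ⟨_, ⟨A, rfl⟩, rfl⟩ x
    simp only [Ub.compUnif_apply, Ub.sum_apply]
    rw [abs_of_nonneg (hsum0 A _)]
    exact p1 A _
  · rw [Ub.sum_apply]
    exact le_antisymm (p1 A _) ((hone x).symm.le.trans (ple A x hx (φ x)))
  · choose V hVY hVW using hV
    refine ⟨⋂ a ∈ A, V a, (biInter_finset_mem A).2 fun a _ => hVY a, fun x x' hx hxx' => ?_⟩
    rw [Ub.sum_apply] at hx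
    obtain ⟨a, ha, hax⟩ := Finset.exists_ne_zero_of_sum_ne_zero hx
    exact hVW a x x' (psupp A a _ hax) (mem_iInter₂.1 hxx' a ha)

theorem HasLocalBumps.isLocalizing {φ : X → Y} (hφ : UniformContinuous φ)
    (h : HasLocalBumps φ) : IsLocalizing φ hφ := by
  intro W hW
  obtain ⟨p, p0, p1, hueb, hone, -, hV⟩ := h.exists_partitions hφ hW
  refine ⟨_, hueb, ?_, fun A => ⟨_, ⟨A, rfl⟩, hone A⟩, ?_⟩
  · rintro _ ⟨A, rfl⟩ y
    refine ⟨?_, p1 A y⟩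
    simp only [Ub.sum_apply]
    exact Finset.sum_nonneg fun a _ => p0 A a y
  · rintro _ ⟨A, rfl⟩
    exact hV A

end Partitions

/-! ### Joins of two preuniformities -/

section Join

variable {X Y Z₁ Z₂ : Type*} [UniformSpace X] [UniformSpace Y] [UniformSpace Z₁] [UniformSpace Z₂]

theorem Ub.compUnif_mul {φ : X → Y} (hφ : UniformContinuous φ) (f g : Ub Y) :
    Ub.compUnif φ hφ (Ub.mul f g) = Ub.mul (Ub.compUnif φ hφ f) (Ub.compUnif φ hφ g) := rfl

/-- If `X` carries the join of the structures of `Z₁` and `Z₂`, then products of functions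
localizing for `Z₁` and for `Z₂` are localizing for `X`. -/
theorem IsLocalizing.join {ρ₁ : X → Z₁} {ρ₂ : X → Z₂} {φ₁ : Z₁ → Y} {φ₂ : Z₂ → Y} {φ : X → Y}
    {hφ₁ : UniformContinuous φ₁} {hφ₂ : UniformContinuous φ₂} (hφ : UniformContinuous φ)
    (hρ₁ : UniformContinuous ρ₁) (hρ₂ : UniformContinuous ρ₂)
    (h₁ : ∀ x, φ₁ (ρ₁ x) = φ x) (h₂ : ∀ x, φ₂ (ρ₂ x) = φ x)
    (hX : ∀ W ∈ 𝓤 X, ∃ W₁ ∈ 𝓤 Z₁, ∃ W₂ ∈ 𝓤 Z₂, ∀ x x', (ρ₁ x, ρ₁ x') ∈ W₁ →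
      (ρ₂ x, ρ₂ x') ∈ W₂ → (x, x') ∈ W)
    (hl₁ : IsLocalizing φ₁ hφ₁) (hl₂ : IsLocalizing φ₂ hφ₂) : IsLocalizing φ hφ := by
  classical
  intro W hW
  obtain ⟨W₁, hW₁, W₂, hW₂, hWW⟩ := hX W hW
  obtain ⟨𝒢₁, hueb₁, h01₁, hone₁, hV₁⟩ := hl₁ W₁ hW₁
  obtain ⟨𝒢₂, hueb₂, h01₂, hone₂, hV₂⟩ := hl₂ W₂ hW₂
  refine ⟨image2 Ub.mul 𝒢₁ 𝒢₂, ?_, ?_, fun A => ?_, ?_⟩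
  · refine (IsUeb.image2_mul (hueb₁.image_compUnif ρ₁ hρ₁) (hueb₂.image_compUnif ρ₂ hρ₂)).mono ?_
    rintro _ ⟨_, ⟨g₁, hg₁, g₂, hg₂, rfl⟩, rfl⟩
    refine ⟨_, ⟨_, ⟨g₁, hg₁, rfl⟩, rfl⟩, _, ⟨_, ⟨g₂, hg₂, rfl⟩, rfl⟩, Ub.ext fun x => ?_⟩
    simp only [Ub.mul_apply, Ub.compUnif_apply, h₁, h₂]
  · rintro _ ⟨g₁, hg₁, g₂, hg₂, rfl⟩ y
    have a := h01₁ g₁ hg₁ y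
    have b := h01₂ g₂ hg₂ y
    exact ⟨mul_nonneg a.1 b.1, mul_le_one₀ a.2 b.1 b.2⟩
  · obtain ⟨g₁, hg₁, hA₁⟩ := hone₁ (A.image ρ₁)
    obtain ⟨g₂, hg₂, hA₂⟩ := hone₂ (A.image ρ₂)
    refine ⟨_, ⟨g₁, hg₁, g₂, hg₂, rfl⟩, fun x hx => ?_⟩
    rw [Ub.mul_apply]
    nth_rewrite 1 [← h₁ x]
    rw [← h₂ x, hA₁ _ (Finset.mem_image_of_mem _ hx), hA₂ _ (Finset.mem_image_of_mem _ hx), one_mul]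
  · rintro _ ⟨g₁, hg₁, g₂, hg₂, rfl⟩
    obtain ⟨V₁, hVY₁, hVW₁⟩ := hV₁ g₁ hg₁
    obtain ⟨V₂, hVY₂, hVW₂⟩ := hV₂ g₂ hg₂
    refine ⟨V₁ ∩ V₂, inter_mem hVY₁ hVY₂, fun x x' hx hxx' => hWW x x' ?_ ?_⟩
    · refine hVW₁ _ _ ?_ ?_
      · rw [h₁]
        exact left_ne_zero_of_mul hx
      · rw [h₁, h₁]
        exact hxx'.1
    · refine hVW₂ _ _ ?_ ?_
      · rw [h₂]
        exact right_ne_zero_of_mul hx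
      · rw [h₂, h₂]
        exact hxx'.2

/-- The norm of a functional, with norming functions. -/
theorem UbDual.exists_norm (m : UbDual X) :
    ∃ M : ℝ, 0 ≤ M ∧ (∀ (f : Ub X) (c : ℝ), 0 ≤ c → (∀ x, |(f : X →ᵇ ℝ) x| ≤ c) →
      |m f| ≤ M * c) ∧ ∀ ε > 0, ∃ h : Ub X, (∀ x, |(h : X →ᵇ ℝ) x| ≤ 1) ∧ M - ε < m h := by
  obtain ⟨B, hB, hbound⟩ := m.exists_bound
  set s : Set ℝ := {r | ∃ h : Ub X, (∀ x, |(h : X →ᵇ ℝ) x| ≤ 1) ∧ m h = r} with hs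
  have h0 : (0 : ℝ) ∈ s := ⟨0, fun x => by simp, map_zero m⟩
  have hbdd : BddAbove s := by
    refine ⟨B * 1, ?_⟩
    rintro _ ⟨h, hh, rfl⟩
    exact (le_abs_self _).trans (hbound h 1 zero_le_one hh)
  have hle : ∀ (f : Ub X) (c : ℝ), 0 < c → (∀ x, |(f : X →ᵇ ℝ) x| ≤ c) → m f ≤ sSup s * c := by
    intro f c hc hf
    rw [← div_le_iff₀ hc]
    refine le_csSup hbdd ⟨c⁻¹ • f, fun x => ?_, ?_⟩
    · change |c⁻¹ * (f : X →ᵇ ℝ) x| ≤ 1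
      rw [abs_mul, abs_of_pos (inv_pos.2 hc), inv_mul_le_iff₀ hc, mul_one]
      exact hf x
    · rw [UbDual.apply_smul, div_eq_inv_mul]
  refine ⟨sSup s, le_csSup hbdd h0, fun f c hc hf => ?_, fun ε hε => ?_⟩
  · rcases hc.eq_or_lt with rfl | hc
    · simpa using hbound f 0 le_rfl hf
    · have h1 := hle (-f) c hc fun x => by
        change |-(f : X →ᵇ ℝ) x| ≤ c
        rw [abs_neg]
        exact hf x
      rw [show m (-f) = -m f from map_neg m f] at h1
      exact abs_le.2 ⟨by linarith, hle f c hc hf⟩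
  · obtain ⟨_, ⟨h, hh, rfl⟩, hlt⟩ := exists_lt_of_lt_csSup ⟨0, h0⟩ (sub_lt_self (sSup s) hε)
    exact ⟨h, hh, hlt⟩

/-- A functional on `Ub Y` extends along a surjection `φ : X → Y` to a functional on `Ub X`
with the same bound. -/
theorem UbDual.exists_extension {φ : X → Y} (hφ : UniformContinuous φ)
    (hsurj : Function.Surjective φ) (n : UbDual Y) {M : ℝ} (hM : 0 ≤ M)
    (hn : ∀ (f : Ub Y) (c : ℝ), 0 ≤ c → (∀ y, |(f : Y →ᵇ ℝ) y| ≤ c) → |n f| ≤ M * c) :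
    ∃ m : UbDual X, (∀ f, m (Ub.compUnif φ hφ f) = n f) ∧
      ∀ (f : Ub X) (c : ℝ), 0 ≤ c → (∀ x, |(f : X →ᵇ ℝ) x| ≤ c) → |m f| ≤ M * c := by
  let L : Ub Y →ₗ[ℝ] Ub X :=
    { toFun := Ub.compUnif φ hφ
      map_add' := fun _ _ => rfl
      map_smul' := fun _ _ => rfl }
  have hL : Function.Injective L := fun f g h => Ub.ext fun y => by
    obtain ⟨x, rfl⟩ := hsurj y
    exact congrArg (fun k : Ub X => (k : X →ᵇ ℝ) x) h
  let n' : Ub Y →ₗ[ℝ] ℝ :=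
    { toFun := n
      map_add' := UbDual.apply_add n
      map_smul' := UbDual.apply_smul n }
  let e := LinearEquiv.ofInjective L hL
  let P : Ub X →ₗ.[ℝ] ℝ := ⟨LinearMap.range L, n'.comp e.symm.toLinearMap⟩
  have hP : ∀ f : Ub Y, P ⟨L f, f, rfl⟩ = n f := by
    intro f
    change n (e.symm (e f)) = n f
    rw [LinearEquiv.symm_apply_apply]
  have hsmul_le : ∀ c : ℝ, 0 < c → ∀ f : Ub X, ‖c • f‖ ≤ c * ‖f‖ := fun c hc f =>
    Ub.norm_le_of_forall_abs_le (mul_nonneg hc.le (norm_nonneg f)) fun x => by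
      change |c * (f : X →ᵇ ℝ) x| ≤ _
      rw [abs_mul, abs_of_pos hc]
      exact mul_le_mul_of_nonneg_left (Ub.abs_apply_le_norm f x) hc.le
  have hsmul : ∀ c : ℝ, 0 < c → ∀ f : Ub X, ‖c • f‖ = c * ‖f‖ := fun c hc f => by
    refine (hsmul_le c hc f).antisymm ?_
    have h := hsmul_le c⁻¹ (inv_pos.2 hc) (c • f)
    rwa [inv_smul_smul₀ hc.ne', le_inv_mul_iff₀ hc] at h
  obtain ⟨g, hg, hgN⟩ := exists_extension_of_le_sublinear P (fun f => M * ‖f‖)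
    (fun c hc f => by
      rw [hsmul c hc f]
      ring)
    (fun f f' => by
      rw [← mul_add]
      exact mul_le_mul_of_nonneg_left (norm_add_le f f') hM)
    (by
      rintro ⟨_, f, rfl⟩
      rw [hP]
      refine (le_abs_self _).trans (hn f _ (norm_nonneg (L f)) fun y => ?_)
      obtain ⟨x, rfl⟩ := hsurj y
      exact Ub.abs_apply_le_norm (L f) x)
  have hbound : ∀ (f : Ub X) (c : ℝ), 0 ≤ c → (∀ x, |(f : X →ᵇ ℝ) x| ≤ c) → |g f| ≤ M * c := by
    intro f c hc hf
    have h1 : ‖f‖ ≤ c := Ub.norm_le_of_forall_abs_le hc hf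
    have h1' : ‖-f‖ ≤ c := Ub.norm_le_of_forall_abs_le hc fun x => by
      change |-(f : X →ᵇ ℝ) x| ≤ c
      rw [abs_neg]
      exact hf x
    have h2 := hgN (-f)
    rw [show g (-f) = -g f from map_neg g f] at h2
    have h3 := hgN f
    have h4 := mul_le_mul_of_nonneg_left h1 hM
    have h4' := mul_le_mul_of_nonneg_left h1' hM
    exact abs_le.2 ⟨by linarith, by linarith⟩
  have hcont : Continuous g := by
    refine (LipschitzWith.of_dist_le_mul (K := M.toNNReal) fun f f' => ?_).continuous
    rw [Real.dist_eq, ← map_sub, Real.coe_toNNReal _ hM]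
    refine hbound _ _ dist_nonneg fun x => ?_
    exact (f : X →ᵇ ℝ).dist_coe_le_dist x
  refine ⟨UniformConvergenceCLM.ofFun (RingHom.id ℝ) ℝ _ ⟨g, hcont⟩, fun f => ?_, hbound⟩
  exact (hg ⟨L f, f, rfl⟩).trans (hP f)

/-- If `h` nearly norms the functional `m`, and still does after multiplication by `g`, then `m`
is nearly carried by `g`. This is the total variation estimate `|m| (1 - g) ≤ ε`. -/
theorem UbDual.abs_sub_mul_le {m : UbDual X} {M : ℝ}
    (hm : ∀ (f : Ub X) (c : ℝ), 0 ≤ c → (∀ x, |(f : X →ᵇ ℝ) x| ≤ c) → |m f| ≤ M * c)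
    {h g : Ub X} (hh : ∀ x, |(h : X →ᵇ ℝ) x| ≤ 1)
    (hg : ∀ x, 0 ≤ (g : X →ᵇ ℝ) x ∧ (g : X →ᵇ ℝ) x ≤ 1) {ε : ℝ}
    (hε : M - ε ≤ m (Ub.mul h g)) {f : Ub X} {c : ℝ} (hc : 0 ≤ c)
    (hf : ∀ x, |(f : X →ᵇ ℝ) x| ≤ c) : |m f - m (Ub.mul f g)| ≤ ε * c := by
  have key : ∀ s : ℝ, |s| = 1 → s * (m f - m (Ub.mul f g)) ≤ ε * c := by
    intro s hs
    have h1 := (le_abs_self _).trans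
      -- this function is bounded by `c * g + c * (1 - g) = c`
      (hm (c • Ub.mul h g + s • (f - Ub.mul f g)) c hc fun x => ?_)
    · rw [UbDual.apply_add, UbDual.apply_smul, UbDual.apply_smul, UbDual.apply_sub] at h1
      nlinarith [mul_le_mul_of_nonneg_right hε hc]
    · change |c * ((h : X →ᵇ ℝ) x * (g : X →ᵇ ℝ) x) +
        s * ((f : X →ᵇ ℝ) x - (f : X →ᵇ ℝ) x * (g : X →ᵇ ℝ) x)| ≤ c
      refine (abs_add_le _ _).trans ?_
      rw [← mul_one_sub, abs_mul, abs_mul, abs_mul, abs_mul, hs, abs_of_nonneg hc,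
        abs_of_nonneg (hg x).1, abs_of_nonneg (sub_nonneg.2 (hg x).2), one_mul]
      have a1 := mul_le_mul_of_nonneg_right (hh x) (hg x).1
      have a2 := mul_le_mul_of_nonneg_left a1 hc
      have a3 := mul_le_mul_of_nonneg_right (hf x) (sub_nonneg.2 (hg x).2)
      linarith
  have k1 := key 1 abs_one
  have k2 := key (-1) (by simp)
  exact abs_le.2 ⟨by linarith, by linarith⟩

/-- A functional is a uniform measure when it is nearly carried by finite partitions into functions
with small supports. -/
theorem mem_UMeas_of_partitions {κ : Type*} {m : UbDual X}
    (h : ∀ F : Set (Ub X), IsUeb F → ∀ ε > 0, ∃ (K : Finset κ) (r : κ → Ub X),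
      (∀ k x, 0 ≤ (r k : X →ᵇ ℝ) x) ∧ (∀ x, ((∑ k ∈ K, r k : Ub X) : X →ᵇ ℝ) x ≤ 1) ∧
      (∀ k x x', (r k : X →ᵇ ℝ) x ≠ 0 → (r k : X →ᵇ ℝ) x' ≠ 0 →
        ∀ f ∈ F, |(f : X →ᵇ ℝ) x - (f : X →ᵇ ℝ) x'| ≤ ε) ∧
      ∀ f ∈ F, |m f - m (Ub.mul f (∑ k ∈ K, r k))| ≤ ε) : m ∈ UMeas X := by
  obtain ⟨M, hM, hbound⟩ := m.exists_bound
  refine mem_UMeas_iff.2 fun F hF δ hδ => ?_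
  set ε : ℝ := δ / (M + 2) with hε_def
  have hε : 0 < ε := by positivity
  obtain ⟨K, r, r0, r1, hsmall, htail⟩ := h F hF ε hε
  have hex : ∀ k, ∃ n ∈ Mol X, ∀ f ∈ F, ∀ x, (r k : X →ᵇ ℝ) x ≠ 0 →
      |(f : X →ᵇ ℝ) x - n f| ≤ ε := by
    intro k
    by_cases hk : ∃ x, (r k : X →ᵇ ℝ) x ≠ 0
    · obtain ⟨x₀, hx₀⟩ := hk
      exact ⟨pmass x₀, Submodule.subset_span ⟨x₀, rfl⟩, fun f hf x hx => hsmall k x x₀ hx hx₀ f hf⟩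
    -- if `r k = 0`, its weight `m (r k)` vanishes and no point is needed
    · exact ⟨0, Submodule.zero_mem _, fun f _ x hx => (hk ⟨x, hx⟩).elim⟩
  choose n hn hnr using hex
  refine ⟨∑ k ∈ K, m (r k) • n k, Submodule.sum_mem _ fun k _ => Submodule.smul_mem _ _ (hn k),
    fun f hf => ?_⟩
  have hsum : (∑ k ∈ K, m (r k) • n k : UbDual X) f = m (∑ k ∈ K, n k f • r k) := by
    have e1 : ∀ K : Finset κ, (∑ k ∈ K, m (r k) • n k : UbDual X) f = ∑ k ∈ K, m (r k) * n k f := by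
      classical
      intro K
      induction K using Finset.induction_on with
      | empty => rfl
      | insert k K hk ih =>
        rw [Finset.sum_insert hk, Finset.sum_insert hk, ← ih]
        rfl
    have e2 : ∀ K : Finset κ, m (∑ k ∈ K, n k f • r k) = ∑ k ∈ K, m (r k) * n k f := by
      classical
      intro K
      induction K using Finset.induction_on with
      | empty => exact map_zero m
      | insert k K hk ih =>
        rw [Finset.sum_insert hk, Finset.sum_insert hk, ← ih, UbDual.apply_add, UbDual.apply_smul,
          mul_comm]
    rw [e1, e2]
  have hk := hbound (Ub.mul f (∑ k ∈ K, r k) - ∑ k ∈ K, n k f • r k) ε hε.le fun x => by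
    have e3 : ((Ub.mul f (∑ k ∈ K, r k) - ∑ k ∈ K, n k f • r k : Ub X) : X →ᵇ ℝ) x =
        ∑ k ∈ K, ((f : X →ᵇ ℝ) x - n k f) * (r k : X →ᵇ ℝ) x := by
      change (f : X →ᵇ ℝ) x * ((∑ k ∈ K, r k : Ub X) : X →ᵇ ℝ) x -
        ((∑ k ∈ K, n k f • r k : Ub X) : X →ᵇ ℝ) x = _
      rw [Ub.sum_apply, Ub.sum_apply, Finset.mul_sum, ← Finset.sum_sub_distrib]
      refine Finset.sum_congr rfl fun k _ => ?_
      rw [sub_mul]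
      rfl
    rw [e3]
    have hr1 := r1 x
    rw [Ub.sum_apply] at hr1
    calc |∑ k ∈ K, ((f : X →ᵇ ℝ) x - n k f) * (r k : X →ᵇ ℝ) x|
        ≤ ∑ k ∈ K, |((f : X →ᵇ ℝ) x - n k f) * (r k : X →ᵇ ℝ) x| :=
          Finset.abs_sum_le_sum_abs _ _
      _ ≤ ∑ k ∈ K, ε * (r k : X →ᵇ ℝ) x := by
          refine Finset.sum_le_sum fun k _ => ?_
          rw [abs_mul, abs_of_nonneg (r0 k x)]
          by_cases hx : (r k : X →ᵇ ℝ) x = 0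
          · rw [hx, mul_zero, mul_zero]
          · exact mul_le_mul_of_nonneg_right (hnr k f hf x hx) (r0 k x)
      _ = ε * ∑ k ∈ K, (r k : X →ᵇ ℝ) x := by rw [Finset.mul_sum]
      _ ≤ ε := mul_le_of_le_one_right hε.le hr1
  rw [UbDual.apply_sub, ← hsum] at hk
  have ht := htail f hf
  have hδε : (M + 2) * ε = δ := by
    rw [hε_def]
    field_simp
  have hk' := abs_le.1 hk
  have ht' := abs_le.1 ht
  refine abs_lt.2 ⟨by linarith, by linarith⟩

/-- If `m` extends, with the same norm, the image in `Y` of a uniform measure on `Z`, then `m` is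
nearly carried by some function of each family of functions on `Y` that is uniformly equicontinuous
on `Z` and takes the value `1` on finite sets. -/
theorem exists_abs_sub_mul_compUnif_le {Z : Type*} [UniformSpace Z] {φ : X → Y} {φ' : Z → Y}
    (hφ : UniformContinuous φ) (hφ' : UniformContinuous φ') {m : UbDual X} {n : UbDual Y}
    {m' : UMeas Z} (hm : ∀ f, m (Ub.compUnif φ hφ f) = n f)
    (hm' : ∀ f, (m' : UbDual Z) (Ub.compUnif φ' hφ' f) = n f) {M : ℝ}
    (hM : ∀ (f : Ub X) (c : ℝ), 0 ≤ c → (∀ x, |(f : X →ᵇ ℝ) x| ≤ c) → |m f| ≤ M * c)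
    (hn : ∀ ε > 0, ∃ h : Ub Y, (∀ y, |(h : Y →ᵇ ℝ) y| ≤ 1) ∧ M - ε < n h)
    {g : Finset Z → Ub Y} (hg : ∀ A y, 0 ≤ (g A : Y →ᵇ ℝ) y ∧ (g A : Y →ᵇ ℝ) y ≤ 1)
    (hueb : IsUeb (Ub.compUnif φ' hφ' '' range g))
    (hone : ∀ A, ∀ x ∈ A, (g A : Y →ᵇ ℝ) (φ' x) = 1) {ε : ℝ} (hε : 0 < ε) :
    ∃ A, ∀ (f : Ub X) (c : ℝ), 0 ≤ c → (∀ x, |(f : X →ᵇ ℝ) x| ≤ c) →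
      |m f - m (Ub.mul f (Ub.compUnif φ hφ (g A)))| ≤ ε * c := by
  obtain ⟨h, hh, hnh⟩ := hn (ε / 2) (half_pos hε)
  have hs := isUeb_singleton (Ub.compUnif φ' hφ' h)
  obtain ⟨A, hA⟩ := UMeas.exists_finset m'.2 (hs.union (hs.image2_mul hueb)) (half_pos hε)
  refine ⟨A, fun f c hc hf => UbDual.abs_sub_mul_le hM (h := Ub.compUnif φ hφ h)
    (fun x => hh (φ x)) (fun x => hg A (φ x)) ?_ hc hf⟩
  have h1 := abs_lt.1 (hA _ (Or.inl rfl)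
    (Ub.mul (Ub.compUnif φ' hφ' h) (Ub.compUnif φ' hφ' (g A)))
    (Or.inr ⟨_, rfl, _, ⟨_, ⟨A, rfl⟩, rfl⟩, rfl⟩)
    (fun x hx => by rw [Ub.mul_apply, Ub.compUnif_apply _ _ (g A), hone A x hx, mul_one]))
  rw [← Ub.compUnif_mul, hm', hm'] at h1
  rw [← Ub.compUnif_mul, hm]
  linarith

/-- Let `X` carry the join of the structures of `Z₁` and `Z₂`. Uniform measures on `Z₁` and `Z₂`
with the same image in `Y` come from a uniform measure on `X`. It is any Hahn–Banach extension of
the common image: being norm-preserving, the extension is nearly carried by finitely many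
sets that are small in both `Z₁` and `Z₂`, hence in `X`. -/
theorem exists_UMeas_of_map_eq {ρ₁ : X → Z₁} {ρ₂ : X → Z₂} {φ₁ : Z₁ → Y} {φ₂ : Z₂ → Y}
    {φ : X → Y} (hφ₁ : UniformContinuous φ₁) (hφ₂ : UniformContinuous φ₂)
    (hφ : UniformContinuous φ) (hsurj : Function.Surjective φ)
    (h₁ : ∀ x, φ₁ (ρ₁ x) = φ x) (h₂ : ∀ x, φ₂ (ρ₂ x) = φ x)
    (hX : ∀ W ∈ 𝓤 X, ∃ W₁ ∈ 𝓤 Z₁, ∃ W₂ ∈ 𝓤 Z₂, ∀ x x', (ρ₁ x, ρ₁ x') ∈ W₁ →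
      (ρ₂ x, ρ₂ x') ∈ W₂ → (x, x') ∈ W)
    (hb₁ : HasLocalBumps φ₁) (hb₂ : HasLocalBumps φ₂) {m₁ : UMeas Z₁} {m₂ : UMeas Z₂}
    (hm : UMeas.map φ₁ hφ₁ m₁ = UMeas.map φ₂ hφ₂ m₂) :
    ∃ m : UMeas X, UMeas.map φ hφ m = UMeas.map φ₁ hφ₁ m₁ := by
  let n : UbDual Y := (UMeas.map φ₁ hφ₁ m₁ : UMeas Y)
  have hn₁ : ∀ f, (m₁ : UbDual Z₁) (Ub.compUnif φ₁ hφ₁ f) = n f := fun _ => rfl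
  have hn₂ : ∀ f, (m₂ : UbDual Z₂) (Ub.compUnif φ₂ hφ₂ f) = n f := fun f => by
    change _ = (UMeas.map φ₁ hφ₁ m₁ : UbDual Y) f
    rw [hm]
    rfl
  obtain ⟨M, hM, hMn, hnorm⟩ := n.exists_norm
  obtain ⟨m, hmn, hMm⟩ := UbDual.exists_extension hφ hsurj n hM hMn
  refine ⟨⟨m, ?_⟩, Subtype.ext (UniformConvergenceCLM.ext _ _ hmn)⟩
  refine mem_UMeas_of_partitions (κ := Z₁ × Z₂) fun F hF δ hδ => ?_
  obtain ⟨hequi, C, hC, hFC⟩ := isUeb_iff.1 hF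
  obtain ⟨W₁, hW₁, W₂, hW₂, hWW⟩ := hX _ (hequi δ hδ)
  obtain ⟨D₁, hD₁, symm₁, comp₁⟩ := comp_symm_mem_uniformity_sets hW₁
  obtain ⟨D₂, hD₂, symm₂, comp₂⟩ := comp_symm_mem_uniformity_sets hW₂
  obtain ⟨p, p0, p1, pueb, pone, psmall, -⟩ := hb₁.exists_partitions hφ₁ hD₁
  obtain ⟨q, q0, q1, queb, qone, qsmall, -⟩ := hb₂.exists_partitions hφ₂ hD₂
  have hp : ∀ (A : Finset Z₁) y, 0 ≤ ((∑ a ∈ A, p A a : Ub Y) : Y →ᵇ ℝ) y := fun A y => by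
    rw [Ub.sum_apply]
    exact Finset.sum_nonneg fun a _ => p0 A a y
  have hq : ∀ (A : Finset Z₂) y, 0 ≤ ((∑ a ∈ A, q A a : Ub Y) : Y →ᵇ ℝ) y := fun A y => by
    rw [Ub.sum_apply]
    exact Finset.sum_nonneg fun a _ => q0 A a y
  set ε : ℝ := δ / (2 * C + 1) with hε_def
  have hε : 0 < ε := by positivity
  obtain ⟨A, hA⟩ := exists_abs_sub_mul_compUnif_le hφ hφ₁ hmn hn₁ hMm hnorm
    (fun A y => ⟨hp A y, p1 A y⟩) pueb pone hε
  obtain ⟨B, hB⟩ := exists_abs_sub_mul_compUnif_le hφ hφ₂ hmn hn₂ hMm hnorm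
    (fun A y => ⟨hq A y, q1 A y⟩) queb qone hε
  have hsum : ∑ k ∈ A ×ˢ B, Ub.compUnif φ hφ (Ub.mul (p A k.1) (q B k.2)) =
      Ub.mul (Ub.compUnif φ hφ (∑ a ∈ A, p A a)) (Ub.compUnif φ hφ (∑ b ∈ B, q B b)) := by
    refine Ub.ext fun x => ?_
    simp only [Ub.sum_apply, Ub.mul_apply, Ub.compUnif_apply]
    rw [Finset.sum_mul_sum, Finset.sum_product]
  refine ⟨A ×ˢ B, fun k => Ub.compUnif φ hφ (Ub.mul (p A k.1) (q B k.2)),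
    fun k x => mul_nonneg (p0 _ _ _) (q0 _ _ _), fun x => ?_, ?_, fun f hf => ?_⟩
  · rw [hsum]
    exact mul_le_one₀ (p1 A _) (hq B _) (q1 B _)
  · rintro ⟨a, b⟩ x x' hx hx' f hf
    refine (hWW x x' ?_ ?_ f hf).le
    · have e : (p A a : Y →ᵇ ℝ) (φ₁ (ρ₁ x)) ≠ 0 := by
        rw [h₁]
        exact left_ne_zero_of_mul hx
      have e' : (p A a : Y →ᵇ ℝ) (φ₁ (ρ₁ x')) ≠ 0 := by
        rw [h₁]
        exact left_ne_zero_of_mul hx'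
      exact comp₁ ⟨a, symm₁.symm _ _ (psmall A a _ e), psmall A a _ e'⟩
    · have e : (q B b : Y →ᵇ ℝ) (φ₂ (ρ₂ x)) ≠ 0 := by
        rw [h₂]
        exact right_ne_zero_of_mul hx
      have e' : (q B b : Y →ᵇ ℝ) (φ₂ (ρ₂ x')) ≠ 0 := by
        rw [h₂]
        exact right_ne_zero_of_mul hx'
      exact comp₂ ⟨b, symm₂.symm _ _ (qsmall B b _ e), qsmall B b _ e'⟩
  · rw [hsum]
    have t1 := abs_le.1 (hA f C hC (hFC f hf))
    have t2 := abs_le.1 (hB (Ub.mul f (Ub.compUnif φ hφ (∑ a ∈ A, p A a))) C hC fun x => by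
      rw [Ub.mul_apply, abs_mul, Ub.compUnif_apply, abs_of_nonneg (hp A _)]
      exact (mul_le_of_le_one_right (abs_nonneg _) (p1 A _)).trans (hFC f hf x))
    have hassoc : Ub.mul (Ub.mul f (Ub.compUnif φ hφ (∑ a ∈ A, p A a)))
        (Ub.compUnif φ hφ (∑ b ∈ B, q B b)) = Ub.mul f
        (Ub.mul (Ub.compUnif φ hφ (∑ a ∈ A, p A a)) (Ub.compUnif φ hφ (∑ b ∈ B, q B b))) :=
      Ub.ext fun x => by simp only [Ub.mul_apply, mul_assoc]
    rw [hassoc] at t2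
    have hδε : (2 * C + 1) * ε = δ := by
      rw [hε_def]
      field_simp
    exact abs_le.2 ⟨by linarith, by linarith⟩

end Join

/-! ### Gauges and functions on cosets -/

section CosetFunctions

variable {G : Type*} [Group G]

/-- The gauge of a coset translated on both sides: the infimum of `N (a * x * b)` over the
elements `x` of the coset `p`. -/
noncomputable def cosetGauge {H : Subgroup G} (N : G → ℝ) (a b : G) (p : G ⧸ H) : ℝ :=
  ⨅ x : {x : G // (x : G ⧸ H) = p}, N (a * x * b)

/-- The bump function on `G ⧸ H` associated with a gauge. -/
noncomputable def cosetBump {H : Subgroup G} (N : G → ℝ) (a b : G) (p : G ⧸ H) : ℝ :=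
  max 0 (1 - cosetGauge N a b p)

variable {H : Subgroup G} {N : G → ℝ}

theorem nonempty_coset (p : G ⧸ H) : Nonempty {x : G // (x : G ⧸ H) = p} :=
  let ⟨x, hx⟩ := QuotientGroup.mk_surjective p
  ⟨⟨x, hx⟩⟩

theorem cosetBump_nonneg (a b : G) (p : G ⧸ H) : 0 ≤ cosetBump N a b p := le_max_left _ _

theorem exists_lt_one_of_cosetBump_ne_zero {a b : G} {p : G ⧸ H} (h : cosetBump N a b p ≠ 0) :
    ∃ x : G, (x : G ⧸ H) = p ∧ N (a * x * b) < 1 := by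
  have := nonempty_coset p
  have h1 : cosetGauge N a b p < 1 := by
    by_contra! h1
    exact h (max_eq_left (by linarith))
  obtain ⟨⟨x, hx⟩, hx'⟩ := exists_lt_of_ciInf_lt h1
  exact ⟨x, hx, hx'⟩

theorem cosetBump_le_add {a b : G} {p q : G ⧸ H} {δ : ℝ} (hδ : 0 ≤ δ)
    (h : cosetGauge N a b q ≤ cosetGauge N a b p + δ) :
    cosetBump N a b p ≤ cosetBump N a b q + δ := by
  refine max_le (add_nonneg (cosetBump_nonneg a b q) hδ) ?_
  have : 1 - cosetGauge N a b q ≤ cosetBump N a b q := le_max_right _ _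
  linarith

/-- The cosets of `x` and `v * x * w` with `v` and `w` in `U`. -/
def wedgeRel (H : Subgroup G) (U : Set G) : Set ((G ⧸ H) × (G ⧸ H)) :=
  {p | ∃ x : G, (x : G ⧸ H) = p.1 ∧ ∃ v ∈ U, ∃ w ∈ U, ((v * x * w : G) : G ⧸ H) = p.2}

theorem monotone_wedgeRel : Monotone (wedgeRel H) := by
  rintro U U' h p ⟨x, hx, v, hv, w, hw, hp⟩
  exact ⟨x, hx, v, h hv, w, h hw, hp⟩

end CosetFunctions

section Gauge

variable {G : Type*} [Group G] [TopologicalSpace G]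

/-- A gauge on a topological group: a seminorm (for the group operation) that is continuous at the
identity. -/
structure IsGauge (N : G → ℝ) : Prop where
  one : N 1 = 0
  nonneg : ∀ x, 0 ≤ N x
  mul_le : ∀ x y, N (x * y) ≤ N x + N y
  inv : ∀ x, N x⁻¹ = N x
  eventually_lt : ∀ ε > 0, ∀ᶠ x in 𝓝 1, N x < ε

/-- Every neighbourhood of the identity contains the open unit ball of a gauge. The gauge is
`x ↦ sup_g d (g x, g)` for a pseudometric `d` that is uniformly continuous for the left
uniformity. -/
theorem exists_isGauge [IsTopologicalGroup G] {U : Set G} (hU : U ∈ 𝓝 (1 : G)) :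
    ∃ N : G → ℝ, IsGauge N ∧ ∀ x, N x < 1 → x ∈ U := by
  have hV : (fun p : G × G => p.1⁻¹ * p.2) ⁻¹' U ∈
      @uniformity G (IsTopologicalGroup.leftUniformSpace G) := preimage_mem_comap hU
  obtain ⟨d, d_self, d_comm, d_tri, d_nonneg, d_le, d_unif, hd⟩ :=
    @exists_pseudometric_of_mem_uniformity G (IsTopologicalGroup.leftUniformSpace G) _ hV
  have hbdd : ∀ x, BddAbove (range fun g => d (g * x) g) := fun x => by
    refine ⟨1, ?_⟩
    rintro _ ⟨g, rfl⟩
    exact d_le _ _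
  have hle : ∀ x g, d (g * x) g ≤ ⨆ g, d (g * x) g := fun x g => le_ciSup (hbdd x) g
  refine ⟨fun x => ⨆ g, d (g * x) g, ⟨?_, fun x => ?_, fun x y => ?_, fun x => ?_, fun ε hε => ?_⟩,
    fun x hx => ?_⟩
  · simp [d_self]
  · exact (d_nonneg _ _).trans (hle x 1)
  · refine ciSup_le fun g => (d_tri _ (g * x) _).trans ?_
    rw [← mul_assoc, add_comm]
    exact add_le_add (hle x g) (hle y (g * x))
  · refine le_antisymm (ciSup_le fun g => ?_) (ciSup_le fun g => ?_)
    · have := hle x (g * x⁻¹)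
      rwa [inv_mul_cancel_right, d_comm] at this
    · have := hle x⁻¹ (g * x)
      rwa [mul_inv_cancel_right, d_comm] at this
  · obtain ⟨V, hV, hVd⟩ := mem_comap.1 (d_unif (ε / 2) (half_pos hε))
    filter_upwards [hV] with x hx
    refine (ciSup_le fun g => ?_).trans_lt (half_lt_self hε)
    rw [d_comm]
    have : (g, g * x) ∈ (fun p : G × G => p.1⁻¹ * p.2) ⁻¹' V := by
      simpa using hx
    exact le_of_lt (hVd this)
  · have := hd 1 x (by
      rw [d_comm]
      simpa using (hle x 1).trans_lt hx)
    simpa using this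

variable {H : Subgroup G} {N : G → ℝ}

theorem IsGauge.cosetGauge_nonneg (hN : IsGauge N) (a b : G) (p : G ⧸ H) :
    0 ≤ cosetGauge N a b p :=
  Real.iInf_nonneg fun _ => hN.nonneg _

theorem IsGauge.cosetGauge_le (hN : IsGauge N) (a b x : G) :
    cosetGauge N a b (x : G ⧸ H) ≤ N (a * x * b) :=
  ciInf_le (f := fun x' : {x' : G // (x' : G ⧸ H) = x} => N (a * x' * b))
    ⟨0, by rintro _ ⟨y, rfl⟩; exact hN.nonneg _⟩ ⟨x, rfl⟩

theorem IsGauge.cosetBump_le_one (hN : IsGauge N) (a b : G) (p : G ⧸ H) :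
    cosetBump N a b p ≤ 1 :=
  max_le zero_le_one (by linarith [hN.cosetGauge_nonneg a b p])

theorem IsGauge.cosetBump_eq_one (hN : IsGauge N) {a b x : G} (h : a * x * b = 1) :
    cosetBump N a b (x : G ⧸ H) = 1 := by
  have h1 : cosetGauge N a b (x : G ⧸ H) ≤ 0 := by
    refine (hN.cosetGauge_le a b x).trans ?_
    rw [h, hN.one]
  exact (hN.cosetBump_le_one a b _).antisymm (le_max_of_le_right (by linarith))

/-- Left translations: the estimate is uniform in `b`. -/
theorem IsGauge.cosetBump_left [IsTopologicalGroup G] (hN : IsGauge N) (a : G) {ε : ℝ}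
    (hε : 0 < ε) :
    ∃ V ∈ 𝓝 (1 : G), ∀ v ∈ V, ∀ b x : G,
      cosetBump N a b (x : G ⧸ H) ≤ cosetBump N a b ((v * x : G) : G ⧸ H) + ε := by
  have hconj : Tendsto (fun v : G => a * v * a⁻¹) (𝓝 1) (𝓝 1) := by
    have : Continuous fun v : G => a * v * a⁻¹ := by fun_prop
    simpa using this.tendsto 1
  refine ⟨_, hconj.eventually (hN.eventually_lt ε hε), fun v hv b x => ?_⟩
  refine cosetBump_le_add hε.le ?_
  rw [← sub_le_iff_le_add]
  have := nonempty_coset (x : G ⧸ H)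
  refine le_ciInf fun ⟨y, hy⟩ => ?_
  rw [sub_le_iff_le_add]
  have hvy : ((v * y : G) : G ⧸ H) = ((v * x : G) : G ⧸ H) := by
    rw [QuotientGroup.eq] at hy ⊢
    simpa [mul_assoc] using hy
  rw [← hvy]
  refine (hN.cosetGauge_le a b (v * y)).trans ?_
  have h1 := hN.mul_le (a * v * a⁻¹) (a * y * b)
  have h2 : a * v * a⁻¹ * (a * y * b) = a * (v * y) * b := by group
  rw [h2] at h1
  have h3 : N (a * v * a⁻¹) < ε := hv
  dsimp only
  linarith

/-- Neutrality in terms of cosets: a small right translate of an element of `yH` lies in the coset of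
a small right translate of `y` itself. -/
theorem IsNeutralSubgroup.exists_nhds (hH : IsNeutralSubgroup H) {U : Set G} (hU : U ∈ 𝓝 (1 : G)) :
    ∃ V ∈ 𝓝 (1 : G), ∀ v ∈ V, ∀ x y : G, (x : G ⧸ H) = y →
      ∃ u ∈ U, ((x * v : G) : G ⧸ H) = ((y * u : G) : G ⧸ H) := by
  obtain ⟨V, hV, hVU⟩ := hH U hU
  refine ⟨V, hV, fun v hv x y hxy => ?_⟩
  have hk : y⁻¹ * x ∈ H := QuotientGroup.eq.1 hxy.symm
  obtain ⟨u, hu, k, hk', huk⟩ := hVU (mul_mem_mul hk hv)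
  refine ⟨u, hu, ?_⟩
  have h1 : x * v = y * u * k := by
    change u * k = y⁻¹ * x * v at huk
    rw [mul_assoc, huk]
    group
  rw [h1, QuotientGroup.mk_mul_of_mem _ hk']

/-- Right translations: the estimate is uniform in `a`. -/
theorem IsGauge.cosetBump_right [IsTopologicalGroup G] (hH : IsNeutralSubgroup H)
    (hN : IsGauge N) (b : G) {ε : ℝ} (hε : 0 < ε) :
    ∃ V ∈ 𝓝 (1 : G), ∀ v ∈ V, ∀ a x : G,
      cosetBump N a b (x : G ⧸ H) ≤ cosetBump N a b ((x * v : G) : G ⧸ H) + ε := by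
  have hconj : Tendsto (fun v : G => b⁻¹ * v * b) (𝓝 1) (𝓝 1) := by
    have : Continuous fun v : G => b⁻¹ * v * b := by fun_prop
    simpa using this.tendsto 1
  obtain ⟨V, hV, hVU⟩ := hH.exists_nhds (hconj.eventually (hN.eventually_lt ε hε))
  refine ⟨V, hV, fun v hv a x => cosetBump_le_add hε.le ?_⟩
  rw [← sub_le_iff_le_add]
  have := nonempty_coset (x : G ⧸ H)
  refine le_ciInf fun ⟨y, hy⟩ => ?_
  rw [sub_le_iff_le_add]
  obtain ⟨u, hu, hxu⟩ := hVU v hv x y hy.symm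
  rw [hxu]
  refine (hN.cosetGauge_le a b (y * u)).trans ?_
  have h1 := hN.mul_le (a * y * b) (b⁻¹ * u * b)
  have h2 : a * y * b * (b⁻¹ * u * b) = a * (y * u) * b := by group
  rw [h2] at h1
  have h3 : N (b⁻¹ * u * b) < ε := hu
  dsimp only
  linarith

end Gauge

/-! ### Preuniformities on the coset space -/

theorem uniformContinuous_finalUnif {S T Z : Type*} {u : UniformSpace S} {q : S → T}
    {uZ : UniformSpace Z} {f : T → Z} (h : @UniformContinuous S Z u uZ (f ∘ q)) :
    @UniformContinuous T Z (finalUnif u q) uZ f := by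
  rw [uniformContinuous_iff_le_comap]
  refine sInf_le ?_
  exact uniformContinuous_comap' h

/-- Uniform equicontinuity for a final structure can be checked before the quotient. -/
theorem eventually_finalUnif {S T ι : Type*} {u : UniformSpace S} {q : S → T} {f : ι → T → ℝ}
    (h : ∀ ε > 0, ∀ᶠ p in @uniformity S u, ∀ i, |f i (q p.1) - f i (q p.2)| < ε) :
    ∀ ε > 0, ∀ᶠ p in @uniformity T (finalUnif u q), ∀ i, |f i p.1 - f i p.2| < ε := by
  have h1 : @UniformEquicontinuous ι ℝ S _ u fun i s => f i (q s) := by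
    intro U hU
    obtain ⟨ε, hε, hU⟩ := Metric.mem_uniformity_dist.1 hU
    exact (h ε hε).mono fun p hp i => hU (hp i)
  have h2 : @UniformEquicontinuous ι ℝ T _ (finalUnif u q) f :=
    (@uniformEquicontinuous_iff_uniformContinuous ι ℝ T _ (finalUnif u q) f).2
      (uniformContinuous_finalUnif
        ((@uniformEquicontinuous_iff_uniformContinuous ι ℝ S _ u fun i s => f i (q s)).1 h1))
  exact fun ε hε => h2 _ (Metric.dist_mem_uniformity hε)

section Cosets

variable {G : Type*} [Group G] [TopologicalSpace G] [IsTopologicalGroup G] {H : Subgroup G}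

theorem eventually_unifL {ι : Type*} {f : ι → G ⧸ H → ℝ}
    (h : ∀ ε > 0, ∃ V ∈ 𝓝 (1 : G), ∀ v ∈ V, ∀ i, ∀ x : G,
      f i (x : G ⧸ H) ≤ f i ((x * v : G) : G ⧸ H) + ε) :
    ∀ ε > 0, ∀ᶠ p in @uniformity _ (unifL H), ∀ i, |f i p.1 - f i p.2| < ε := by
  refine eventually_finalUnif fun ε hε => ?_
  obtain ⟨V, hV, hVf⟩ := h (ε / 2) (half_pos hε)
  refine mem_comap.2 ⟨V ∩ V⁻¹, inter_mem hV (inv_mem_nhds_one G hV), ?_⟩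
  rintro ⟨x, y⟩ ⟨h1, h2⟩ i
  have e1 := hVf _ h1 i x
  have e2 := hVf _ h2 i y
  simp only [mul_inv_cancel_left, mul_inv_rev, inv_inv] at e1 e2
  refine abs_lt.2 ⟨?_, ?_⟩ <;> dsimp only <;> linarith

theorem eventually_unifR {ι : Type*} {f : ι → G ⧸ H → ℝ}
    (h : ∀ ε > 0, ∃ V ∈ 𝓝 (1 : G), ∀ v ∈ V, ∀ i, ∀ x : G,
      f i (x : G ⧸ H) ≤ f i ((v * x : G) : G ⧸ H) + ε) :
    ∀ ε > 0, ∀ᶠ p in @uniformity _ (unifR H), ∀ i, |f i p.1 - f i p.2| < ε := by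
  refine eventually_finalUnif fun ε hε => ?_
  obtain ⟨V, hV, hVf⟩ := h (ε / 2) (half_pos hε)
  refine mem_comap.2 ⟨V ∩ V⁻¹, inter_mem hV (inv_mem_nhds_one G hV), ?_⟩
  rintro ⟨x, y⟩ ⟨h1, h2⟩ i
  have e1 := hVf _ h1 i x
  have e2 := hVf _ h2 i y
  simp only [inv_mul_cancel_right, mul_inv_rev, inv_inv] at e1 e2
  refine abs_lt.2 ⟨?_, ?_⟩ <;> dsimp only <;> linarith

theorem exists_nhds_of_mem_unifL {W : Set ((G ⧸ H) × (G ⧸ H))} (hW : W ∈ @uniformity _ (unifL H)) :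
    ∃ U ∈ 𝓝 (1 : G), ∀ x y : G, x⁻¹ * y ∈ U → ((x : G ⧸ H), (y : G ⧸ H)) ∈ W := by
  obtain ⟨U, hU, hUW⟩ := mem_comap.1 ((isLeast_finalUnif (IsTopologicalGroup.leftUniformSpace G)
    (QuotientGroup.mk : G → G ⧸ H)).1 hW)
  exact ⟨U, hU, fun x y h => @hUW (x, y) h⟩

theorem exists_nhds_of_mem_unifR {W : Set ((G ⧸ H) × (G ⧸ H))} (hW : W ∈ @uniformity _ (unifR H)) :
    ∃ U ∈ 𝓝 (1 : G), ∀ x y : G, y * x⁻¹ ∈ U → ((x : G ⧸ H), (y : G ⧸ H)) ∈ W := by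
  obtain ⟨U, hU, hUW⟩ := mem_comap.1 ((isLeast_finalUnif (IsTopologicalGroup.rightUniformSpace G)
    (QuotientGroup.mk : G → G ⧸ H)).1 hW)
  exact ⟨U, hU, fun x y h => @hUW (x, y) h⟩

/-- For a neutral subgroup, the relations `wedgeRel H U` form a base of a preuniformity coarser
than those of `Q_L` and `Q_R`. Hence they are entourages of `Q_∧`. -/
theorem IsNeutralSubgroup.wedgeRel_mem (hH : IsNeutralSubgroup H) {U : Set G}
    (hU : U ∈ 𝓝 (1 : G)) : wedgeRel H U ∈ @uniformity _ (unifWedge H) := by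
  have hmem : ∀ {r : Set ((G ⧸ H) × (G ⧸ H))},
      r ∈ (𝓝 (1 : G)).lift' (wedgeRel H) ↔ ∃ U ∈ 𝓝 (1 : G), wedgeRel H U ⊆ r :=
    mem_lift'_sets monotone_wedgeRel
  let c : UniformSpace.Core (G ⧸ H) := UniformSpace.Core.mk' ((𝓝 (1 : G)).lift' (wedgeRel H))
    (fun r hr p => by
      obtain ⟨U, hU, hr⟩ := hmem.1 hr
      obtain ⟨x, rfl⟩ := QuotientGroup.mk_surjective p
      exact hr ⟨x, rfl, 1, mem_of_mem_nhds hU, 1, mem_of_mem_nhds hU, by simp⟩)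
    (fun r hr => by
      obtain ⟨U, hU, hr⟩ := hmem.1 hr
      refine hmem.2 ⟨U⁻¹, inv_mem_nhds_one G hU, ?_⟩
      rintro ⟨p, q⟩ ⟨x, hx, v, hv, w, hw, hq⟩
      refine hr ⟨_, hq, v⁻¹, hv, w⁻¹, hw, ?_⟩
      rw [← mul_assoc, ← mul_assoc, inv_mul_cancel, one_mul, mul_inv_cancel_right]
      exact hx)
    (fun r hr => by
      obtain ⟨U, hU, hr⟩ := hmem.1 hr
      obtain ⟨V, hV, hVU⟩ := exists_nhds_one_split hU
      obtain ⟨V', hV', hVV'⟩ := hH.exists_nhds hV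
      refine ⟨wedgeRel H (V ∩ V'), hmem.2 ⟨_, inter_mem hV hV', subset_rfl⟩, ?_⟩
      rintro ⟨p, s⟩ ⟨q, ⟨x, hx, v, hv, w, hw, hq⟩, ⟨y, hy, v', hv', w', hw', hs⟩⟩
      have hyq : ((v' * y : G) : G ⧸ H) = ((v' * (v * x * w) : G) : G ⧸ H) := by
        have := QuotientGroup.eq.1 (hy.trans hq.symm)
        rw [QuotientGroup.eq]
        simpa [mul_assoc] using this
      obtain ⟨u, hu, hyu⟩ := hVV' w' hw'.2 _ _ hyq
      refine hr ⟨x, hx, v' * v, hVU _ hv'.1 _ hv.1, w * u, hVU _ hw.1 _ hu, ?_⟩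
      rw [← hs]
      refine Eq.trans ?_ hyu.symm
      simp only [mul_assoc])
  have hle : unifWedge H ≤ UniformSpace.ofCore c := by
    refine sup_le (sInf_le ?_) (sInf_le ?_)
    · intro r hr
      obtain ⟨U, hU, hr⟩ := hmem.1 hr
      refine mem_comap.2 ⟨U, hU, fun p hp => hr ⟨p.1, rfl, 1, mem_of_mem_nhds hU, _, hp, ?_⟩⟩
      rw [one_mul, mul_inv_cancel_left]
    · intro r hr
      obtain ⟨U, hU, hr⟩ := hmem.1 hr
      refine mem_comap.2 ⟨U, hU, fun p hp => hr ⟨p.1, rfl, _, hp, 1, mem_of_mem_nhds hU, ?_⟩⟩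
      rw [mul_one, inv_mul_cancel_right]
  exact hle (hmem.2 ⟨U, hU, subset_rfl⟩)

/-- The bump function `cosetBump N a b` as a function on `Q_∧`. -/
noncomputable def wedgeBump (hH : IsNeutralSubgroup H) {N : G → ℝ} (hN : IsGauge N) (a b : G) :
    Ub (WithUnif (G ⧸ H) (unifWedge H)) :=
  Ub.ofFun (X := WithUnif (G ⧸ H) (unifWedge H)) (cosetBump N a b : G ⧸ H → ℝ)
    (by
      change @UniformContinuous (G ⧸ H) ℝ (unifL H ⊔ unifR H) _ (cosetBump N a b)
      rw [uniformContinuous_iff_le_comap]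
      refine sup_le ?_ ?_
      · rw [← uniformContinuous_iff_le_comap]
        refine @uniformContinuous_of_abs_sub_lt _ (unifL H) _ fun ε hε => ?_
        refine (eventually_unifL (f := fun _ : Unit => cosetBump N a b) (fun ε hε => ?_) ε hε).mono
          fun p hp => hp ()
        obtain ⟨V, hV, h⟩ := hN.cosetBump_right hH b hε
        exact ⟨V, hV, fun v hv _ x => h v hv a x⟩
      · rw [← uniformContinuous_iff_le_comap]
        refine @uniformContinuous_of_abs_sub_lt _ (unifR H) _ fun ε hε => ?_
        refine (eventually_unifR (f := fun _ : Unit => cosetBump N a b) (fun ε hε => ?_) ε hε).mono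
          fun p hp => hp ()
        obtain ⟨V, hV, h⟩ := hN.cosetBump_left a hε
        exact ⟨V, hV, fun v hv _ x => h v hv b x⟩)
    1 (fun p => by
      rw [abs_of_nonneg (cosetBump_nonneg a b p)]
      exact hN.cosetBump_le_one a b p)

/-- Every neighbourhood of the identity contains the products of four elements of the open unit
ball of some gauge. -/
theorem exists_isGauge_mul4 {U : Set G} (hU : U ∈ 𝓝 (1 : G)) :
    ∃ N : G → ℝ, IsGauge N ∧
      ∀ x y z w, N x < 1 → N y < 1 → N z < 1 → N w < 1 → x * y * z * w ∈ U := by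
  obtain ⟨V, hV, hVU⟩ := exists_nhds_one_split4 hU
  obtain ⟨N, hN, hNV⟩ := exists_isGauge hV
  exact ⟨N, hN, fun x y z w hx hy hz hw => hVU (hNV x hx) (hNV y hy) (hNV z hz) (hNV w hw)⟩

theorem IsGauge.eventually_conj {N : G → ℝ} (hN : IsGauge N) (a : G) :
    ∀ᶠ v in 𝓝 (1 : G), N (a⁻¹ * v * a) < 1 := by
  have hconj : Tendsto (fun v : G => a⁻¹ * v * a) (𝓝 1) (𝓝 1) := by
    have : Continuous fun v : G => a⁻¹ * v * a := by fun_prop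
    simpa using this.tendsto 1
  exact hconj.eventually (hN.eventually_lt 1 one_pos)

/-- The bumps at the coset `αH` depend on `α⁻¹ x`. On their supports, `x = α u` with `u` small, a
small left translation `v x = x (u⁻¹ (α⁻¹ v α) u)` is also a small right translation. -/
theorem hasLocalBumps_unifL (hH : IsNeutralSubgroup H) :
    HasLocalBumps (WithUnif.iota (unifL H) (unifWedge H)) := by
  intro W hW
  obtain ⟨U, hU, hUW⟩ := exists_nhds_of_mem_unifL hW
  obtain ⟨N, hN, hNU⟩ := exists_isGauge_mul4 hU
  have h1 : N 1 < 1 := hN.one.trans_lt one_pos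
  refine ⟨fun a => wedgeBump hH hN (Quotient.out (s := QuotientGroup.leftRel H) a)⁻¹ 1,
    fun a y => ⟨cosetBump_nonneg _ _ _, hN.cosetBump_le_one _ _ _⟩, ?_, fun a => ?_, fun a x hx => ?_,
    fun a => ?_⟩
  · refine eventually_unifL (f := fun a : G ⧸ H => cosetBump N
      (Quotient.out (s := QuotientGroup.leftRel H) a)⁻¹ 1) fun ε hε => ?_
    obtain ⟨V, hV, h⟩ := hN.cosetBump_right hH 1 hε
    exact ⟨V, hV, fun v hv a x => h v hv _ x⟩
  · obtain ⟨α, hα⟩ : ∃ α : G, α = Quotient.out (s := QuotientGroup.leftRel H) a := ⟨_, rfl⟩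
    have hαa : (α : G ⧸ H) = a := by rw [hα]; exact QuotientGroup.out_eq' a
    change cosetBump N _ 1 a = 1
    rw [← hα, ← hαa]
    exact hN.cosetBump_eq_one (by simp)
  · obtain ⟨α, hα⟩ : ∃ α : G, α = Quotient.out (s := QuotientGroup.leftRel H) a := ⟨_, rfl⟩
    have hαa : (α : G ⧸ H) = a := by rw [hα]; exact QuotientGroup.out_eq' a
    obtain ⟨x₀, hx₀, hlt⟩ := exists_lt_one_of_cosetBump_ne_zero hx
    rw [← hα, mul_one] at hlt
    have := hUW α x₀ (by simpa using hNU 1 1 1 _ h1 h1 h1 hlt)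
    rwa [hαa, hx₀] at this
  · obtain ⟨α, hα⟩ : ∃ α : G, α = Quotient.out (s := QuotientGroup.leftRel H) a := ⟨_, rfl⟩
    obtain ⟨V, hV, hVN⟩ := hH.exists_nhds (hN.eventually_lt 1 one_pos)
    refine ⟨_, hH.wedgeRel_mem (inter_mem hV (hN.eventually_conj α)), fun x x' hx hxx' => ?_⟩
    obtain ⟨x₀, hx₀, hlt⟩ := exists_lt_one_of_cosetBump_ne_zero hx
    rw [← hα, mul_one] at hlt
    obtain ⟨y, hy, v, hv, w, hw, hx'⟩ := hxx'
    have hvy : ((v * y : G) : G ⧸ H) = ((v * x₀ : G) : G ⧸ H) := by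
      have := QuotientGroup.eq.1 (hy.trans hx₀.symm)
      rw [QuotientGroup.eq]
      simpa [mul_assoc] using this
    obtain ⟨u, hu, hvu⟩ := hVN w hw.1 _ _ hvy
    have hmem := hUW x₀ (v * x₀ * u) (by
      have := hNU (α⁻¹ * x₀)⁻¹ (α⁻¹ * v * α) (α⁻¹ * x₀) u (by rwa [hN.inv]) hv.2 hlt hu
      convert this using 1
      group)
    rw [hx₀, ← hvu, hx'] at hmem
    exact hmem

/-- The bumps at the coset `αH` depend on `x α⁻¹`. On their supports, `x = u α` with `u` small, a
small right translation `x w = (u (α w α⁻¹) u⁻¹) x` is also a small left translation. -/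
theorem hasLocalBumps_unifR (hH : IsNeutralSubgroup H) :
    HasLocalBumps (WithUnif.iota (unifR H) (unifWedge H)) := by
  intro W hW
  obtain ⟨U, hU, hUW⟩ := exists_nhds_of_mem_unifR hW
  obtain ⟨N, hN, hNU⟩ := exists_isGauge_mul4 hU
  have h1 : N 1 < 1 := hN.one.trans_lt one_pos
  refine ⟨fun a => wedgeBump hH hN 1 (Quotient.out (s := QuotientGroup.leftRel H) a)⁻¹,
    fun a y => ⟨cosetBump_nonneg _ _ _, hN.cosetBump_le_one _ _ _⟩, ?_, fun a => ?_, fun a x hx => ?_,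
    fun a => ?_⟩
  · refine eventually_unifR (f := fun a : G ⧸ H => cosetBump N 1
      (Quotient.out (s := QuotientGroup.leftRel H) a)⁻¹) fun ε hε => ?_
    obtain ⟨V, hV, h⟩ := hN.cosetBump_left (H := H) 1 hε
    exact ⟨V, hV, fun v hv a x => h v hv _ x⟩
  · obtain ⟨α, hα⟩ : ∃ α : G, α = Quotient.out (s := QuotientGroup.leftRel H) a := ⟨_, rfl⟩
    have hαa : (α : G ⧸ H) = a := by rw [hα]; exact QuotientGroup.out_eq' a
    change cosetBump N 1 _ a = 1
    rw [← hα, ← hαa]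
    exact hN.cosetBump_eq_one (by simp)
  · obtain ⟨α, hα⟩ : ∃ α : G, α = Quotient.out (s := QuotientGroup.leftRel H) a := ⟨_, rfl⟩
    have hαa : (α : G ⧸ H) = a := by rw [hα]; exact QuotientGroup.out_eq' a
    obtain ⟨x₀, hx₀, hlt⟩ := exists_lt_one_of_cosetBump_ne_zero hx
    rw [← hα, one_mul] at hlt
    have := hUW α x₀ (by simpa using hNU 1 1 1 _ h1 h1 h1 hlt)
    rwa [hαa, hx₀] at this
  · obtain ⟨α, hα⟩ : ∃ α : G, α = Quotient.out (s := QuotientGroup.leftRel H) a := ⟨_, rfl⟩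
    obtain ⟨V, hV, hVN⟩ := hH.exists_nhds (hN.eventually_conj α⁻¹)
    refine ⟨_, hH.wedgeRel_mem (inter_mem hV (hN.eventually_lt 1 one_pos)),
      fun x x' hx hxx' => ?_⟩
    obtain ⟨x₀, hx₀, hlt⟩ := exists_lt_one_of_cosetBump_ne_zero hx
    rw [← hα, one_mul] at hlt
    obtain ⟨y, hy, v, hv, w, hw, hx'⟩ := hxx'
    have hvy : ((v * y : G) : G ⧸ H) = ((v * x₀ : G) : G ⧸ H) := by
      have := QuotientGroup.eq.1 (hy.trans hx₀.symm)
      rw [QuotientGroup.eq]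
      simpa [mul_assoc] using this
    obtain ⟨u, hu, hvu⟩ := hVN w hw.1 _ _ hvy
    have hmem := hUW x₀ (v * x₀ * u) (by
      have := hNU v (x₀ * α⁻¹) (α⁻¹⁻¹ * u * α⁻¹) (x₀ * α⁻¹)⁻¹ hv.2 hlt hu (by rwa [hN.inv])
      convert this using 1
      group)
    rw [hx₀, ← hvu, hx'] at hmem
    exact hmem

/-- The join is generated by intersections of entourages of `Q_L` and of `Q_R`. -/
theorem exists_of_mem_unifVee {W : Set ((G ⧸ H) × (G ⧸ H))}
    (hW : W ∈ @uniformity _ (unifVee H)) :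
    ∃ W₁ ∈ @uniformity _ (unifL H), ∃ W₂ ∈ @uniformity _ (unifR H),
      ∀ x x' : G ⧸ H, (x, x') ∈ W₁ → (x, x') ∈ W₂ → (x, x') ∈ W := by
  rw [inf_uniformity] at hW
  obtain ⟨W₁, hW₁, W₂, hW₂, rfl⟩ := mem_inf_iff.1 hW
  exact ⟨W₁, hW₁, W₂, hW₂, fun x x' h h' => ⟨h, h'⟩⟩

theorem isLocalizing_unifVee (hH : IsNeutralSubgroup H) :
    IsLocalizing (WithUnif.iota (unifVee H) (unifWedge H))
      (WithUnif.uniformContinuous_iota (unifVee_le_Wedge H)) :=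
  IsLocalizing.join (ρ₁ := WithUnif.iota (unifVee H) (unifL H))
    (ρ₂ := WithUnif.iota (unifVee H) (unifR H)) _
    (WithUnif.uniformContinuous_iota (unifVee_le_L H))
    (WithUnif.uniformContinuous_iota (unifVee_le_R H)) (fun _ => rfl) (fun _ => rfl)
    (fun _ hW => exists_of_mem_unifVee hW)
    ((hasLocalBumps_unifL hH).isLocalizing (WithUnif.uniformContinuous_iota (unifL_le_Wedge H)))
    ((hasLocalBumps_unifR hH).isLocalizing (WithUnif.uniformContinuous_iota (unifR_le_Wedge H)))

/-- Uniform measures on `Q_L` and on `Q_R` with the same image come from `Q_∨`. -/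
theorem IsNeutralSubgroup.exists_extMap_eq (hH : IsNeutralSubgroup H)
    {m₁ : UMeas (WithUnif (G ⧸ H) (unifL H))} {m₂ : UMeas (WithUnif (G ⧸ H) (unifR H))}
    (hm : extMap (unifL H) (unifWedge H) (unifL_le_Wedge H) m₁ =
      extMap (unifR H) (unifWedge H) (unifR_le_Wedge H) m₂) :
    ∃ m, extMap (unifVee H) (unifWedge H) (unifVee_le_Wedge H) m =
      extMap (unifL H) (unifWedge H) (unifL_le_Wedge H) m₁ :=
  exists_UMeas_of_map_eq (ρ₁ := WithUnif.iota (unifVee H) (unifL H))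
    (ρ₂ := WithUnif.iota (unifVee H) (unifR H))
    (φ₁ := WithUnif.iota (unifL H) (unifWedge H)) (φ₂ := WithUnif.iota (unifR H) (unifWedge H))
    (φ := WithUnif.iota (unifVee H) (unifWedge H))
    (WithUnif.uniformContinuous_iota (unifL_le_Wedge H))
    (WithUnif.uniformContinuous_iota (unifR_le_Wedge H))
    (WithUnif.uniformContinuous_iota (unifVee_le_Wedge H)) Function.surjective_id
    (fun _ => rfl) (fun _ => rfl) (fun _ hW => exists_of_mem_unifVee hW)
    (hasLocalBumps_unifL hH) (hasLocalBumps_unifR hH) hm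

end Cosets

/-! ### Compositions of identity mappings -/

section Composition

variable {S : Type*} {u v w : UniformSpace S}

theorem continuous_extMapPos (h : u ≤ v) : Continuous (extMapPos u v h) :=
  (extMap u v h).continuous.restrict
    (UMeas.mapsTo_pos (WithUnif.iota u v) (WithUnif.uniformContinuous_iota h))

theorem extMap_extMap (huv : u ≤ v) (hvw : v ≤ w) (m : UMeas (WithUnif S u)) :
    extMap v w hvw (extMap u v huv m) = extMap u w (huv.trans hvw) m := rfl

theorem injective_extMap_of_le (huv : u ≤ v) (hvw : v ≤ w)
    (h : Function.Injective (extMap u w (huv.trans hvw))) : Function.Injective (extMap u v huv) :=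
  Function.Injective.of_comp (f := extMap v w hvw) h

theorem isEmbedding_extMapPos_of_le (huv : u ≤ v) (hvw : v ≤ w)
    (h : IsEmbedding (extMapPos u w (huv.trans hvw))) : IsEmbedding (extMapPos u v huv) :=
  IsEmbedding.of_comp (continuous_extMapPos huv) (continuous_extMapPos hvw) h

end Composition

/-! ### Point masses and the necessity of neutrality -/

/-- The point mass at `x` as a positive uniform measure. -/
noncomputable def pmassPos {X : Type*} [UniformSpace X] (x : X) : UMeasPos X :=
  ⟨⟨pmass x, (Mol X).le_topologicalClosure (Submodule.subset_span ⟨x, rfl⟩)⟩, fun _ hf => hf x⟩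

theorem tendsto_nhds_UMeasPos_iff {X ι : Type*} [UniformSpace X] {l : Filter ι}
    {a : ι → UMeasPos X} {m : UMeasPos X} :
    Tendsto a l (𝓝 m) ↔ ∀ F : Set (Ub X), IsUeb F → ∀ ε > 0, ∀ᶠ i in l, ∀ f ∈ F,
      |((m : UMeas X) : UbDual X) f - ((a i : UMeas X) : UbDual X) f| < ε := by
  rw [IsInducing.subtypeVal.tendsto_nhds_iff, IsInducing.subtypeVal.tendsto_nhds_iff]
  exact UbDual.tendsto_nhds_iff

theorem continuous_pmassPos {X : Type*} [UniformSpace X] :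
    Continuous (pmassPos : X → UMeasPos X) := by
  refine continuous_iff_continuousAt.2 fun x => tendsto_nhds_UMeasPos_iff.2 fun F hF ε hε => ?_
  filter_upwards [mem_nhds_left x ((isUeb_iff.1 hF).1 ε hε)] with y hy using hy

/-- If `M(Q_∨)⁺` embeds in `M(Q_L)⁺` then, restricting to point masses, `Q_∨` has the topology
of `Q_L`. Therefore `UH`, a neighbourhood of the coset `H` in `Q_R`, is one in `Q_L`. -/
theorem isNeutralSubgroup_of_isEmbedding {G : Type*} [Group G] [TopologicalSpace G]
    [IsTopologicalGroup G] {H : Subgroup G}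
    (h : IsEmbedding (extMapPos (unifVee H) (unifL H) (unifVee_le_L H))) :
    IsNeutralSubgroup H := by
  intro U hU
  obtain ⟨N, hN, hNU⟩ := exists_isGauge hU
  have huc : @UniformContinuous _ ℝ (unifVee H) _ (cosetBump N 1 1 : G ⧸ H → ℝ) := by
    refine @uniformContinuous_of_abs_sub_lt _ (unifVee H) _ fun ε hε => ?_
    have h1 := eventually_unifR (f := fun _ : Unit => (cosetBump N 1 1 : G ⧸ H → ℝ))
      (fun ε hε => by
        obtain ⟨V, hV, h⟩ := hN.cosetBump_left (H := H) 1 hε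
        exact ⟨V, hV, fun v hv _ x => h v hv 1 x⟩) ε hε
    have h2 := h1.filter_mono (UniformSpace.le_def.1 (unifVee_le_R H))
    exact h2.mono fun p hp => hp ()
  let f : Ub (WithUnif (G ⧸ H) (unifVee H)) :=
    Ub.ofFun (X := WithUnif (G ⧸ H) (unifVee H)) (cosetBump N 1 1 : G ⧸ H → ℝ) huc 1
      (fun p => by
        rw [abs_of_nonneg (cosetBump_nonneg 1 1 p)]
        exact hN.cosetBump_le_one 1 1 p)
  let e : WithUnif (G ⧸ H) (unifVee H) := ((1 : G) : G ⧸ H)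
  let ι := WithUnif.iota (unifVee H) (unifL H)
  have hδ : Tendsto pmassPos (comap ι (𝓝 (ι e))) (𝓝 (pmassPos e)) :=
    h.tendsto_nhds_iff.2 ((continuous_pmassPos.tendsto (ι e)).comp tendsto_comap)
  have hev := tendsto_nhds_UMeasPos_iff.1 hδ _ (isUeb_singleton f) 1 one_pos
  obtain ⟨B, hB, hBf⟩ := mem_comap.1 hev
  obtain ⟨W, hW, hWB⟩ := UniformSpace.mem_nhds_iff.1 hB
  obtain ⟨V, hV, hVW⟩ := exists_nhds_of_mem_unifL hW
  refine ⟨V, hV, ?_⟩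
  rintro _ ⟨k, hk, v, hv, rfl⟩
  have hmem : (ι e, ((k * v : G) : G ⧸ H)) ∈ W := by
    have h1 := hVW k (k * v) (by simpa using hv)
    have h2 : (k : G ⧸ H) = ((1 : G) : G ⧸ H) := by
      rw [QuotientGroup.eq]
      simpa using hk
    rwa [h2] at h1
  have hlt : |cosetBump N 1 1 ((1 : G) : G ⧸ H) - cosetBump N 1 1 ((k * v : G) : G ⧸ H)| < 1 :=
    hBf (hWB hmem) f rfl
  rw [hN.cosetBump_eq_one (by simp)] at hlt
  obtain ⟨x, hx, hxN⟩ := exists_lt_one_of_cosetBump_ne_zero (N := N) (a := 1) (b := 1)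
    (p := ((k * v : G) : G ⧸ H)) (by
      intro h0
      rw [h0] at hlt
      simp at hlt)
  refine ⟨x, hNU x (by simpa using hxN), x⁻¹ * (k * v), QuotientGroup.eq.1 hx, ?_⟩
  exact mul_inv_cancel_left _ _

theorem mainTheorem2 {G : Type*} [Group G] [TopologicalSpace G] [IsTopologicalGroup G]
    [T2Space G] (H : Subgroup G) (hH : IsClosed (H : Set G)) :
    (IsNeutralSubgroup H →
      (Function.Injective (extMap (unifVee H) (unifL H) (unifVee_le_L H)) ∧
        IsEmbedding (extMapPos (unifVee H) (unifL H) (unifVee_le_L H))) ∧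
      (Function.Injective (extMap (unifVee H) (unifR H) (unifVee_le_R H)) ∧
        IsEmbedding (extMapPos (unifVee H) (unifR H) (unifVee_le_R H))) ∧
      (Function.Injective (extMap (unifL H) (unifWedge H) (unifL_le_Wedge H)) ∧
        IsEmbedding (extMapPos (unifL H) (unifWedge H) (unifL_le_Wedge H))) ∧
      (Function.Injective (extMap (unifR H) (unifWedge H) (unifR_le_Wedge H)) ∧
        IsEmbedding (extMapPos (unifR H) (unifWedge H) (unifR_le_Wedge H))) ∧
      (Function.Injective (extMap (unifVee H) (unifWedge H) (unifVee_le_Wedge H)) ∧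
        IsEmbedding (extMapPos (unifVee H) (unifWedge H) (unifVee_le_Wedge H))) ∧
      range (extMap (unifVee H) (unifWedge H) (unifVee_le_Wedge H)) =
        range (extMap (unifL H) (unifWedge H) (unifL_le_Wedge H)) ∩ range (extMap (unifR H) (unifWedge H) (unifR_le_Wedge H))) ∧
    (IsEmbedding (extMapPos (unifVee H) (unifL H) (unifVee_le_L H)) → IsNeutralSubgroup H) := by
  refine ⟨fun hN => ?_, isNeutralSubgroup_of_isEmbedding⟩
  have hL := (hasLocalBumps_unifL hN).isLocalizing
    (WithUnif.uniformContinuous_iota (unifL_le_Wedge H))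
  have hR := (hasLocalBumps_unifR hN).isLocalizing
    (WithUnif.uniformContinuous_iota (unifR_le_Wedge H))
  have hV := isLocalizing_unifVee hN
  have hinj : Function.Injective (extMap (unifVee H) (unifWedge H) (unifVee_le_Wedge H)) :=
    hV.injective_map
  have hemb : IsEmbedding (extMapPos (unifVee H) (unifWedge H) (unifVee_le_Wedge H)) :=
    hV.isEmbedding_mapPos
  refine ⟨⟨injective_extMap_of_le _ (unifL_le_Wedge H) hinj,
      isEmbedding_extMapPos_of_le _ (unifL_le_Wedge H) hemb⟩,
    ⟨injective_extMap_of_le _ (unifR_le_Wedge H) hinj,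
      isEmbedding_extMapPos_of_le _ (unifR_le_Wedge H) hemb⟩,
    ⟨hL.injective_map, hL.isEmbedding_mapPos⟩, ⟨hR.injective_map, hR.isEmbedding_mapPos⟩,
    ⟨hinj, hemb⟩, Subset.antisymm ?_ ?_⟩
  · rintro _ ⟨m, rfl⟩
    exact ⟨⟨_, extMap_extMap (unifVee_le_L H) (unifL_le_Wedge H) m⟩,
      ⟨_, extMap_extMap (unifVee_le_R H) (unifR_le_Wedge H) m⟩⟩
  · rintro _ ⟨⟨m₁, rfl⟩, ⟨m₂, hm⟩⟩
    exact hN.exists_extMap_eq hm.symm
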